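/- Let $k$ be an infinite field of characteristic different from $2$ and $3$, and let $\mathbb{O}=\mathrm{M}_2(k)\oplus \mathrm{M}_2(k)$ be the split octonion algebra over $k$, with trace $\mathrm{tr}$, conjugation $x\mapsto\overline{x}$ and norm $\|\cdot\|$. Let $\mathcal{J}$ be the $27$-dimensional space of Hermitian matrices $$X=\begin{pmatrix} s_1 & x_3 & \overline{x_2}\\ \overline{x_3} & s_2 & x_1\\ x_2 & \overline{x_1} & s_3\end{pmatrix},\qquad s_i\in k,\ x_i\in\mathbb{O},$$ with the cubic form $\det X=s_1s_2s_3+\mathrm{tr}((x_1x_2)x_3)-s_1\|x_1\|-s_2\|x_2\|-s_3\|x_3\|$. Let $GE_6(k)$ be the group of $g\in \mathrm{GL}(\mathcal{J})$ such that, for some $c\in k^\times$, $\det(gX)=c\det X$ for all $X\in\mathcal J$. Let $G_k=GE_6(k)\times \mathrm{GL}_2(k)$ act on $V_k=\mathcal{J}\otimes k^2$, regarded as the space of pairs $x=(x_1,x_2)$ of elements of $\mathcal J$. Let $V^{\mathrm{ss}}_k$ be the set of $x\in V_k$ for which the binary cubic form $F_x(v)=\det(x_1v_1+x_2v_2)$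 has nonzero discriminant. Let $\mathcal{V}_k\subset V_k$ be the subspace of pairs of ternary quadratic forms (pairs of symmetric $3\times 3$ matrices over $k$), and let $\mathcal{V}^{\mathrm{ss}}_k\subset\mathcal{V}_k$ be the set of pairs $x$ for which the discriminant of $F_x$ (with the usual determinant of symmetric matrices) is nonzero. For $x\in\mathcal{V}^{\mathrm{ss}}_k$ let $\mathrm{Zero}_{\mathbb{P}^2}(x)\subset\mathbb{P}^2(\overline{k})$ be the intersection of the two conics defined by $x_1$ and $x_2$; it consists of four distinct points with coordinates in $k^{\mathrm{sep}}$. Identify $\mathrm{H}^1(k,\mathfrak{S}_4)$ with the set of conjugacy classes of continuous homomorphisms $\mathrm{Gal}(k^{\mathrm{sep}}/k)\to\mathfrak{S}_4$ (trivial Galois action on $\mathfrak{S}_4$). The class corresponding to $x$ is that of the homomorphism given by the action of $\mathrm{Gal}(k^{\mathrm{sep}}/k)$ on $\mathrm{Zero}_{\mathbb{P}^2}(x)$, with its points numbered $1,2,3,4$. Let $\mathcal{S}\subset\mathfrak{S}_4$ be the stabilizer of $4$. Then $\mathcal{S}\cong\mathfrak{S}_3$, and every $G_k$-orbit in $V^{\mathrm{ss}}_k$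 has a representative $x\in\mathcal{V}^{\mathrm{ss}}_k$ such that $\mathrm{Zero}_{\mathbb{P}^2}(x)$ contains a $k$-rational point and the class in $\mathrm{H}^1(k,\mathfrak{S}_4)$ corresponding to $x$ lies in the image of the natural map $\mathrm{H}^1(k,\mathcal{S})\to\mathrm{H}^1(k,\mathfrak{S}_4)$. -/

import Mathlib

open scoped Matrix LinearAlgebra.Projectivization

noncomputable section

namespace JordanPairs

/-! ### The split octonions -/

/-- The split octonion algebra over `k`, with underlying space `M₂(k) ⊕ M₂(k)`. -/
def Octonion (k : Type*) : Type _ := Matrix (Fin 2) (Fin 2) k × Matrix (Fin 2) (Fin 2) k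

namespace Octonion

variable {k : Type*} [Field k]

instance : AddCommGroup (Octonion k) :=
  inferInstanceAs (AddCommGroup (Matrix (Fin 2) (Fin 2) k × Matrix (Fin 2) (Fin 2) k))

instance : Module k (Octonion k) :=
  inferInstanceAs (Module k (Matrix (Fin 2) (Fin 2) k × Matrix (Fin 2) (Fin 2) k))

/-- The Cayley–Dickson product `(a, b)(c, d) = (a c + d* b, d a + b c*)`, where `*` (the adjugate)
is the canonical involution of the quaternion algebra `M₂(k)`. -/
instance : Mul (Octonion k) :=
  ⟨fun x y => (x.1 * y.1 + y.2.adjugate * x.2, y.2 * x.1 + x.2 * y.1.adjugate)⟩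

instance : One (Octonion k) := ⟨(1, 0)⟩

/-- Octonion conjugation `(a, b) ↦ (a*, -b)`. -/
def conj (x : Octonion k) : Octonion k := (x.1.adjugate, -x.2)

/-- The trace, `x + conj x = tr x • 1`. -/
def tr (x : Octonion k) : k := x.1.trace

/-- The norm `‖x‖`, a quadratic form with `x * conj x = norm x • 1`. -/
def norm (x : Octonion k) : k := x.1.det - x.2.det

theorem add_conj (x : Octonion k) : x + conj x = tr x • (1 : Octonion k) := by
  refine Prod.ext ?_ ?_
  · change x.1 + x.1.adjugate = x.1.trace • (1 : Matrix (Fin 2) (Fin 2) k)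
    ext i j
    fin_cases i <;> fin_cases j <;> simp [Matrix.adjugate_fin_two, Matrix.trace_fin_two, add_comm]
  · change x.2 + -x.2 = x.1.trace • (0 : Matrix (Fin 2) (Fin 2) k)
    simp

theorem mul_conj (x : Octonion k) : x * conj x = norm x • (1 : Octonion k) := by
  refine Prod.ext ?_ ?_
  · change x.1 * x.1.adjugate + (-x.2).adjugate * x.2
      = (x.1.det - x.2.det) • (1 : Matrix (Fin 2) (Fin 2) k)
    ext i j
    fin_cases i <;> fin_cases j <;>
      simp [Matrix.adjugate_fin_two, Matrix.det_fin_two, Matrix.mul_apply, Matrix.vecMul,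
        dotProduct, Fin.sum_univ_two] <;> ring
  · change -x.2 * x.1 + x.2 * x.1.adjugate.adjugate
      = (x.1.det - x.2.det) • (0 : Matrix (Fin 2) (Fin 2) k)
    ext i j
    fin_cases i <;> fin_cases j <;>
      simp [Matrix.adjugate_fin_two, Matrix.mul_apply, Fin.sum_univ_two]

end Octonion

/-! ### The exceptional Jordan algebra and the group `GE₆` -/

/-- The `27`-dimensional space of Hermitian `3 × 3` matrices over the octonions. The pair
`(s, x)` stands for the matrix with rows
`(s 0, x 2, conj (x 1))`, `(conj (x 2), s 1, x 0)`, `(x 1, conj (x 0), s 2)`. -/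
abbrev J (k : Type*) : Type _ := (Fin 3 → k) × (Fin 3 → Octonion k)

variable {k : Type*} [Field k]

/-- The determinant (cubic norm) of the exceptional Jordan algebra. -/
def J.det (X : J k) : k :=
  X.1 0 * X.1 1 * X.1 2 + (X.2 0 * X.2 1 * X.2 2).tr
    - X.1 0 * (X.2 0).norm - X.1 1 * (X.2 1).norm - X.1 2 * (X.2 2).norm

variable (k) in
/-- `GE₆(k)`: the invertible linear maps of `J` that multiply the determinant by a
nonzero scalar. -/
def GE6 : Subgroup (J k ≃ₗ[k] J k) where
  carrier := {g | ∃ c : kˣ, ∀ X : J k, J.det (g X) = c * J.det X}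
  one_mem' := ⟨1, fun X => by simp⟩
  mul_mem' := by
    rintro g h ⟨c, hc⟩ ⟨d, hd⟩
    exact ⟨c * d, fun X => by simp [LinearEquiv.mul_apply, hc, hd, mul_assoc]⟩
  inv_mem' := by
    rintro g ⟨c, hc⟩
    refine ⟨c⁻¹, fun X => ?_⟩
    have h := hc (g⁻¹ X)
    have hg : g (g⁻¹ X) = X := LinearEquiv.apply_symm_apply g X
    rw [hg] at h
    rw [h, ← mul_assoc, Units.inv_mul, one_mul]

/-- `V = J ⊗ Aff²`, the space of pairs of elements of `J`. -/
abbrev V (k : Type*) : Type _ := Fin 2 → J k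

variable (k) in
/-- The rational points of `G = GE₆ × GL(2)`. -/
abbrev G : Type _ := GE6 k × GL (Fin 2) k

/-- `G` acts on `V = J ⊗ Aff²` by the tensor product of the natural representation of `GE₆` and
the standard representation of `GL(2)`. -/
instance : MulAction (G k) (V k) where
  smul g x := fun i => ∑ j, (g.2 : Matrix (Fin 2) (Fin 2) k) i j • (g.1 : J k ≃ₗ[k] J k) (x j)
  one_smul x := by
    funext i
    change ∑ j, (1 : Matrix (Fin 2) (Fin 2) k) i j • x j = x i
    simp [Matrix.one_apply]
  mul_smul g h x := by
    funext i
    change ∑ j, ((g.2 : Matrix (Fin 2) (Fin 2) k) * (h.2 : Matrix (Fin 2) (Fin 2) k)) i j •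
        (g.1 : J k ≃ₗ[k] J k) ((h.1 : J k ≃ₗ[k] J k) (x j))
      = ∑ j, (g.2 : Matrix (Fin 2) (Fin 2) k) i j • (g.1 : J k ≃ₗ[k] J k)
          (∑ l, (h.2 : Matrix (Fin 2) (Fin 2) k) j l • (h.1 : J k ≃ₗ[k] J k) (x l))
    simp only [Fin.sum_univ_two, Matrix.mul_apply, map_add, map_smul]
    module

/-! ### The binary cubic form of a pair, semi-stable points -/

/-- For a cubic form `D` on a vector space and a pair `x = (x₁, x₂)`, the binary cubic form
`F_x(v) = D(x₁ v₁ + x₂ v₂) = a v₁³ + b v₁² v₂ + c v₁ v₂² + d v₂³`; its coefficients are read off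
from its values at `(1, 0)`, `(0, 1)`, `(1, 1)`, `(1, -1)`. -/
def binaryCubic {M : Type*} [AddCommGroup M] (D : M → k) (x : Fin 2 → M) : Cubic k where
  a := D (x 0)
  b := (D (x 0 + x 1) - D (x 0 - x 1)) / 2 - D (x 1)
  c := (D (x 0 + x 1) + D (x 0 - x 1)) / 2 - D (x 0)
  d := D (x 1)

variable (k) in
/-- The semi-stable points of `V`: the discriminant of `F_x(v) = det (x₁ v₁ + x₂ v₂)` is
nonzero. -/
def Vss : Set (V k) := {x | (binaryCubic J.det x).discr ≠ 0}

/-! ### Pairs of ternary quadratic forms -/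

variable (k) in
/-- Ternary quadratic forms, as symmetric `3 × 3` matrices. -/
def TernaryForm : Submodule k (Matrix (Fin 3) (Fin 3) k) where
  carrier := {A | A.IsSymm}
  add_mem' := Matrix.IsSymm.add
  zero_mem' := Matrix.isSymm_zero
  smul_mem' c _ hA := hA.smul c

/-- The space `𝒱` of pairs of ternary quadratic forms. -/
abbrev QPair (k : Type*) [Field k] : Type _ := Fin 2 → TernaryForm k

variable (k) in
/-- The semi-stable points `𝒱ˢˢ`: the discriminant of `F_x(v) = det (x₁ v₁ + x₂ v₂)` is
nonzero. -/
def QPairss : Set (QPair k) :=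
  {x | (binaryCubic (fun A : TernaryForm k => (A : Matrix (Fin 3) (Fin 3) k).det) x).discr ≠ 0}

/-- A symmetric matrix over `k`, regarded as a Hermitian matrix over the octonions. -/
def TernaryForm.toJ (A : TernaryForm k) : J k :=
  (fun i => A.1 i i, ![A.1 1 2 • 1, A.1 2 0 • 1, A.1 0 1 • 1])

/-- On ternary quadratic forms the determinant of `J` is the determinant of the matrix. -/
theorem TernaryForm.det_toJ (A : TernaryForm k) : J.det (TernaryForm.toJ A) = A.1.det := by
  have h := A.2
  have e : ∀ i j, A.1 i j = A.1 j i := fun i j => (Matrix.IsSymm.apply h j i)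
  have a5 : ∀ (c : k), (c • (1 : Octonion k)).1 = c • (1 : Matrix (Fin 2) (Fin 2) k) := fun _ => rfl
  have a6 : ∀ (c : k), (c • (1 : Octonion k)).2 = c • (0 : Matrix (Fin 2) (Fin 2) k) := fun _ => rfl
  have a7 : ∀ x y : Octonion k, (x * y).1 = x.1 * y.1 + y.2.adjugate * x.2 := fun _ _ => rfl
  have a8 : ∀ x y : Octonion k, (x * y).2 = y.2 * x.1 + x.2 * y.1.adjugate := fun _ _ => rfl
  simp [TernaryForm.toJ, J.det, Octonion.tr, Octonion.norm, a5, a6, a7, a8,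
    Matrix.det_fin_three, Matrix.adjugate_fin_two]
  rw [e 1 0, e 2 0, e 2 1]; ring

/-- The inclusion of `𝒱` in `V`. -/
def QPair.toV (x : QPair k) : V k := fun i => TernaryForm.toJ (x i)

/-! ### The intersection of two conics -/

/-- The points of the projective plane over `K`. -/
abbrev P2 (K : Type*) [Field K] : Type _ := ℙ K (Fin 3 → K)

/-- The map `P²(K) → P²(L)` that applies a homomorphism of fields to the coordinates. -/
def P2.map {K L : Type*} [Field K] [Field L] (f : K →+* L) : P2 K → P2 L :=
  Projectivization.map (σ := f)
    { toFun := fun v i => f (v i)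
      map_add' := fun v w => funext fun i => map_add f (v i) (w i)
      map_smul' := fun c v => funext fun i => map_mul f c (v i) }
    (fun _ _ h => funext fun i => f.injective (congrFun h i))

/-- The intersection in `P²` over the algebraic closure of the conics defined by `x₁`, `x₂`. -/
def zeroP2 (x : QPair k) : Set (P2 (AlgebraicClosure k)) :=
  {p | ∀ i, p.rep ⬝ᵥ ((x i).1.map (algebraMap k (AlgebraicClosure k)) *ᵥ p.rep) = 0}

variable (k) in
/-- `Gal(kˢᵉᵖ/k)`. -/
abbrev GalSep : Type _ := SeparableClosure k ≃ₐ[k] SeparableClosure k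

/-! ### `H¹` with coefficients in a group with trivial Galois action -/

section H1

variable (Γ : Type*) [Group Γ] [TopologicalSpace Γ]

/-- Continuous homomorphisms from `Γ` to the discrete group `A` (those with open kernel). -/
abbrev ContHom (A : Type*) [Group A] : Type _ := {φ : Γ →* A // IsOpen (φ.ker : Set Γ)}

/-- Conjugacy of homomorphisms. -/
instance conjSetoid (A : Type*) [Group A] : Setoid (ContHom Γ A) where
  r φ ψ := ∃ a : A, ∀ σ, ψ.1 σ = a * φ.1 σ * a⁻¹
  iseqv :=
    { refl := fun φ => ⟨1, fun σ => by simp⟩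
      symm := by
        rintro φ ψ ⟨a, ha⟩
        exact ⟨a⁻¹, fun σ => by rw [ha]; group⟩
      trans := by
        rintro φ ψ χ ⟨a, ha⟩ ⟨b, hb⟩
        exact ⟨b * a, fun σ => by rw [hb, ha]; group⟩ }

/-- `H¹(Γ, A)` for a discrete group `A` with trivial action of `Γ`: continuous homomorphisms
`Γ → A` up to conjugation by elements of `A`. -/
def H1 (A : Type*) [Group A] : Type _ := Quotient (conjSetoid Γ A)

variable {Γ} in
/-- The map on `H¹` induced by a homomorphism of coefficient groups. -/
def H1.map [IsTopologicalGroup Γ] {A B : Type*} [Group A] [Group B] (f : A →* B) :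
    H1 Γ A → H1 Γ B :=
  Quotient.map
    (fun φ => ⟨f.comp φ.1, Subgroup.isOpen_mono
      (fun σ hσ => by
        rw [MonoidHom.mem_ker] at hσ ⊢
        rw [MonoidHom.comp_apply, hσ, map_one]) φ.2⟩)
    (by
      rintro φ ψ ⟨a, ha⟩
      exact ⟨f a, fun σ => by simp [ha]⟩)

end H1

/-- `c` is the class in `H¹(k, 𝔖₄)` corresponding to the pair `x`. That is, for a numbering
`p` of the zero set of `x` by four distinct points with coordinates in `kˢᵉᵖ`, the class `c` is
that of the homomorphism `φ` with `σ(p j) = p (φ σ j)` for all `σ` in the Galois group. -/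
def IsClassOf (x : QPair k) (c : H1 (GalSep k) (Equiv.Perm (Fin 4))) : Prop :=
  ∃ p : Fin 4 → P2 (SeparableClosure k), Function.Injective p ∧
    Set.range (fun j =>
      P2.map (algebraMap (SeparableClosure k) (AlgebraicClosure k)) (p j)) = zeroP2 x ∧
    ∃ φ : ContHom (GalSep k) (Equiv.Perm (Fin 4)),
      (∀ (σ : GalSep k) (j : Fin 4),
        P2.map (σ : SeparableClosure k →+* SeparableClosure k) (p j) = p (φ.1 σ j)) ∧
      c = Quotient.mk _ φ

/-- The class corresponding to `x` does not depend on the numbering of the zero set. -/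
theorem IsClassOf.unique {x : QPair k} {c c' : H1 (GalSep k) (Equiv.Perm (Fin 4))}
    (h : IsClassOf x c) (h' : IsClassOf x c') : c = c' := by
  obtain ⟨p, hp, hr, φ, hφ, rfl⟩ := h
  obtain ⟨q, hq, hs, ψ, hψ, rfl⟩ := h'
  have inj : Function.Injective
      (P2.map (algebraMap (SeparableClosure k) (AlgebraicClosure k))) := by
    intro a b
    induction a using Projectivization.ind with | _ v hv
    induction b using Projectivization.ind with | _ w hw
    intro hab
    obtain ⟨i, hi⟩ := Function.ne_iff.1 hw
    obtain ⟨t, ht⟩ := (Projectivization.mk_eq_mk_iff' _ _ _ _ _).1 hab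
    rw [Projectivization.mk_eq_mk_iff']
    have hti := congrFun ht i
    simp only [Pi.smul_apply, LinearMap.coe_mk, AddHom.coe_mk, smul_eq_mul] at hti
    have hi' : algebraMap (SeparableClosure k) (AlgebraicClosure k) (w i) ≠ 0 := by
      simpa using hi
    have htt : t = algebraMap (SeparableClosure k) (AlgebraicClosure k) (v i / w i) := by
      rw [map_div₀, eq_div_iff hi', hti]
    refine ⟨v i / w i, funext fun j => ?_⟩
    apply (algebraMap (SeparableClosure k) (AlgebraicClosure k)).injective
    have htj := congrFun ht j
    simp only [Pi.smul_apply, LinearMap.coe_mk, AddHom.coe_mk, smul_eq_mul] at htj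
    rw [Pi.smul_apply, smul_eq_mul, map_mul, ← htt, htj]
  have hex : ∀ j, ∃ i, p i = q j := by
    intro j
    have hj : P2.map (algebraMap (SeparableClosure k) (AlgebraicClosure k)) (q j) ∈ zeroP2 x :=
      hs ▸ Set.mem_range_self j
    rw [← hr] at hj
    obtain ⟨i, hi⟩ := hj
    exact ⟨i, inj hi⟩
  choose e he using hex
  have einj : Function.Injective e := fun i j hij => hq (by rw [← he, ← he, hij])
  let E : Equiv.Perm (Fin 4) := Equiv.ofBijective e (Finite.injective_iff_bijective.1 einj)
  refine Quotient.sound ⟨E⁻¹, fun σ => Equiv.ext fun j => ?_⟩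
  apply E.injective
  apply hp
  have h1 : p (E (ψ.1 σ j)) = p (φ.1 σ (E j)) := by
    change p (e (ψ.1 σ j)) = p (φ.1 σ (e j))
    rw [he, ← hψ, ← hφ, he]
  simpa [Equiv.Perm.mul_apply] using h1

/-- The subgroup `𝒮` of `𝔖₄` that fixes the last of the four letters. -/
def S : Subgroup (Equiv.Perm (Fin 4)) := MulAction.stabilizer (Equiv.Perm (Fin 4)) (3 : Fin 4)

end JordanPairs

end

open JordanPairs

/-!
Since `GE₆` acts transitively on the elements of nonzero determinant up to scalars, the first
member of a semistable pair can be moved to `base`, whose only nonzero entries are `s₃ = 1` and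
`x₃ = 1`. Unipotent elements preserving the pencil then move the second member until its first
diagonal entry vanishes while `x₂` is invertible: geometrically, the two Hermitian forms acquire a
common isotropic vector. Row operations and triality turn the remaining octonion entries into
scalars, which leaves the pair of conics `2xy + sy² + tz²` and `2xz + s'y² + t'z²`, both passing
through the rational point `(1 : 0 : 0)`. Their other three intersection points are parametrised
by the roots of a separable cubic over `k`, so Galois fixes the first point and permutes the
remaining three.
-/

noncomputable section

namespace JordanPairs

namespace Octonion

section Coordinates

variable {k : Type*}

/-- The octonion with the given eight coordinates, in which identities between octonions can be
verified by commutative algebra. -/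
def ofCoords (a b c d e f g h : k) : Octonion k := (!![a, b; c, d], !![e, f; g, h])

theorem exists_eq_ofCoords (x : Octonion k) :
    ∃ a b c d e f g h, x = ofCoords a b c d e f g h :=
  ⟨_, _, _, _, _, _, _, _, Prod.ext (Matrix.eta_fin_two x.1) (Matrix.eta_fin_two x.2)⟩

theorem ofCoords_inj {a b c d e f g h a' b' c' d' e' f' g' h' : k} :
    ofCoords a b c d e f g h = ofCoords a' b' c' d' e' f' g' h' ↔
      a = a' ∧ b = b' ∧ c = c' ∧ d = d' ∧ e = e' ∧ f = f' ∧ g = g' ∧ h = h' := by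
  refine Prod.mk_inj.trans ?_
  simp [and_assoc]

variable [Field k] (a b c d e f g h a' b' c' d' e' f' g' h' t : k)

theorem add_ofCoords : ofCoords a b c d e f g h + ofCoords a' b' c' d' e' f' g' h' =
    ofCoords (a + a') (b + b') (c + c') (d + d') (e + e') (f + f') (g + g') (h + h') := by
  refine Prod.ext ?_ ?_
  · change !![a, b; c, d] + !![a', b'; c', d'] = _
    simp [ofCoords]
  · change !![e, f; g, h] + !![e', f'; g', h'] = _
    simp [ofCoords]

theorem smul_ofCoords : t • ofCoords a b c d e f g h =
    ofCoords (t * a) (t * b) (t * c) (t * d) (t * e) (t * f) (t * g) (t * h) := by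
  refine Prod.ext ?_ ?_
  · change t • !![a, b; c, d] = _
    simp [ofCoords]
  · change t • !![e, f; g, h] = _
    simp [ofCoords]

theorem mul_ofCoords : ofCoords a b c d e f g h * ofCoords a' b' c' d' e' f' g' h' =
    ofCoords (a * a' + b * c' + (h' * e - f' * g)) (a * b' + b * d' + (h' * f - f' * h))
      (c * a' + d * c' + (e' * g - g' * e)) (c * b' + d * d' + (e' * h - g' * f))
      (e' * a + f' * c + (e * d' - f * c')) (e' * b + f' * d + (f * a' - e * b'))
      (g' * a + h' * c + (g * d' - h * c')) (g' * b + h' * d + (h * a' - g * b')) := by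
  refine Prod.ext ?_ ?_
  · change !![a, b; c, d] * !![a', b'; c', d'] + !![e', f'; g', h'].adjugate * !![e, f; g, h] = _
    simp only [Matrix.adjugate_fin_two_of, ofCoords]
    ext i j
    fin_cases i <;> fin_cases j <;>
      simp only [Matrix.add_apply, Matrix.mul_apply, Fin.sum_univ_two, Matrix.of_apply,
        Matrix.cons_val', Matrix.cons_val_zero, Matrix.cons_val_one, Matrix.cons_val_fin_one,
        Fin.zero_eta, Fin.mk_one, Fin.isValue] <;>
      ring
  · change !![e', f'; g', h'] * !![a, b; c, d] + !![e, f; g, h] * !![a', b'; c', d'].adjugate = _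
    simp only [Matrix.adjugate_fin_two_of, ofCoords]
    ext i j
    fin_cases i <;> fin_cases j <;>
      simp only [Matrix.add_apply, Matrix.mul_apply, Fin.sum_univ_two, Matrix.of_apply,
        Matrix.cons_val', Matrix.cons_val_zero, Matrix.cons_val_one, Matrix.cons_val_fin_one,
        Fin.zero_eta, Fin.mk_one, Fin.isValue] <;>
      ring

theorem conj_ofCoords : conj (ofCoords a b c d e f g h) =
    ofCoords d (-b) (-c) a (-e) (-f) (-g) (-h) := by
  refine Prod.ext ?_ ?_
  · change (!![a, b; c, d]).adjugate = _
    simp [ofCoords, Matrix.adjugate_fin_two_of]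
  · change -!![e, f; g, h] = _
    simp [ofCoords]

theorem tr_ofCoords : tr (ofCoords a b c d e f g h) = a + d := by
  simp [tr, ofCoords, Matrix.trace_fin_two]

theorem norm_ofCoords : norm (ofCoords a b c d e f g h) = a * d - b * c - (e * h - f * g) := by
  simp [norm, ofCoords, Matrix.det_fin_two]

theorem zero_eq_ofCoords : (0 : Octonion k) = ofCoords 0 0 0 0 0 0 0 0 :=
  Prod.ext (Matrix.eta_fin_two 0) (Matrix.eta_fin_two 0)

theorem one_eq_ofCoords : (1 : Octonion k) = ofCoords 1 0 0 1 0 0 0 0 :=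
  Prod.ext Matrix.one_fin_two (Matrix.eta_fin_two 0)

end Coordinates

variable {k : Type*} [Field k]

section Ring

variable (x y z : Octonion k) (t : k)

protected theorem left_distrib : x * (y + z) = x * y + x * z := by
  obtain ⟨x₀, x₁, x₂, x₃, x₄, x₅, x₆, x₇, rfl⟩ := exists_eq_ofCoords x
  obtain ⟨y₀, y₁, y₂, y₃, y₄, y₅, y₆, y₇, rfl⟩ := exists_eq_ofCoords y
  obtain ⟨z₀, z₁, z₂, z₃, z₄, z₅, z₆, z₇, rfl⟩ := exists_eq_ofCoords z
  simp only [add_ofCoords, mul_ofCoords, ofCoords_inj]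
  refine ⟨?_, ?_, ?_, ?_, ?_, ?_, ?_, ?_⟩ <;> ring

protected theorem smul_mul : t • x * y = t • (x * y) := by
  obtain ⟨x₀, x₁, x₂, x₃, x₄, x₅, x₆, x₇, rfl⟩ := exists_eq_ofCoords x
  obtain ⟨y₀, y₁, y₂, y₃, y₄, y₅, y₆, y₇, rfl⟩ := exists_eq_ofCoords y
  simp only [smul_ofCoords, mul_ofCoords, ofCoords_inj]
  refine ⟨?_, ?_, ?_, ?_, ?_, ?_, ?_, ?_⟩ <;> ring

@[simp]
theorem tr_add : tr (x + y) = tr x + tr y := Matrix.trace_add x.1 y.1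

@[simp]
theorem tr_smul : tr (t • x) = t * tr x := Matrix.trace_smul t x.1

@[simp]
theorem tr_zero : tr (0 : Octonion k) = 0 := Matrix.trace_zero (Fin 2) k

@[simp]
theorem tr_one : tr (1 : Octonion k) = 2 := by
  simp only [one_eq_ofCoords, tr_ofCoords, one_add_one_eq_two]

@[simp]
theorem tr_neg : tr (-x) = -tr x := Matrix.trace_neg x.1

@[simp]
theorem tr_sub : tr (x - y) = tr x - tr y := Matrix.trace_sub x.1 y.1

theorem conj_eq : conj x = tr x • 1 - x := eq_sub_of_add_eq' (add_conj x)

@[simp]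
theorem conj_add : conj (x + y) = conj x + conj y := by
  simp only [conj_eq, tr_add, add_smul]
  abel

@[simp]
theorem conj_smul : conj (t • x) = t • conj x := by
  simp only [conj_eq, tr_smul, smul_sub, mul_smul]

@[simp]
theorem conj_neg : conj (-x) = -conj x := by
  simp only [conj_eq, tr_neg, neg_smul]
  abel

@[simp]
theorem conj_zero : conj (0 : Octonion k) = 0 := by
  simp only [conj_eq, tr_zero, zero_smul, sub_zero]

@[simp]
theorem conj_one : conj (1 : Octonion k) = 1 := by
  rw [conj_eq, tr_one, two_smul, add_sub_cancel_right]

@[simp]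
theorem tr_conj : tr (conj x) = tr x := by
  rw [conj_eq, tr_sub, tr_smul, tr_one, mul_two, add_sub_cancel_right]

@[simp]
theorem conj_conj : conj (conj x) = x := by
  rw [conj_eq (conj x), tr_conj, conj_eq, sub_sub_cancel]

@[simp]
protected theorem conj_mul : conj (x * y) = conj y * conj x := by
  obtain ⟨x₀, x₁, x₂, x₃, x₄, x₅, x₆, x₇, rfl⟩ := exists_eq_ofCoords x
  obtain ⟨y₀, y₁, y₂, y₃, y₄, y₅, y₆, y₇, rfl⟩ := exists_eq_ofCoords y
  simp only [mul_ofCoords, conj_ofCoords, ofCoords_inj]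
  refine ⟨?_, ?_, ?_, ?_, ?_, ?_, ?_, ?_⟩ <;> ring

protected theorem right_distrib : (x + y) * z = x * z + y * z := by
  rw [← conj_conj ((x + y) * z), Octonion.conj_mul, conj_add, Octonion.left_distrib, conj_add]
  simp only [Octonion.conj_mul, conj_conj]

protected theorem one_mul : 1 * x = x := by
  obtain ⟨x₀, x₁, x₂, x₃, x₄, x₅, x₆, x₇, rfl⟩ := exists_eq_ofCoords x
  simp only [mul_ofCoords, one_eq_ofCoords, ofCoords_inj]
  refine ⟨?_, ?_, ?_, ?_, ?_, ?_, ?_, ?_⟩ <;> ring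

protected theorem mul_one : x * 1 = x := by
  rw [← conj_conj (x * 1), Octonion.conj_mul, conj_one, Octonion.one_mul, conj_conj]

protected theorem mul_zero : x * 0 = 0 := by
  simpa using Octonion.left_distrib x 0 0

protected theorem zero_mul : 0 * x = 0 := by
  simpa using Octonion.right_distrib 0 0 x

protected theorem mul_smul : x * t • y = t • (x * y) := by
  rw [← conj_conj (x * t • y), Octonion.conj_mul, conj_smul, Octonion.smul_mul, conj_smul,
    ← Octonion.conj_mul, conj_conj]

instance : NonAssocRing (Octonion k) :=
  { (inferInstance : AddCommGroup (Octonion k)) with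
    left_distrib := Octonion.left_distrib
    right_distrib := Octonion.right_distrib
    zero_mul := Octonion.zero_mul
    mul_zero := Octonion.mul_zero
    one_mul := Octonion.one_mul
    mul_one := Octonion.mul_one }

instance : IsScalarTower k (Octonion k) (Octonion k) :=
  ⟨fun t x y => Octonion.smul_mul x y t⟩

instance : SMulCommClass k (Octonion k) (Octonion k) :=
  ⟨fun t x y => (Octonion.mul_smul x y t).symm⟩

instance : FiniteDimensional k (Octonion k) :=
  inferInstanceAs
    (FiniteDimensional k (Matrix (Fin 2) (Fin 2) k × Matrix (Fin 2) (Fin 2) k))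

end Ring

section Composition

variable (x y z b : Octonion k) (t : k)

theorem tr_mul_comm : tr (x * y) = tr (y * x) := by
  obtain ⟨x₀, x₁, x₂, x₃, x₄, x₅, x₆, x₇, rfl⟩ := exists_eq_ofCoords x
  obtain ⟨y₀, y₁, y₂, y₃, y₄, y₅, y₆, y₇, rfl⟩ := exists_eq_ofCoords y
  simp only [mul_ofCoords, tr_ofCoords]
  ring

theorem tr_mul_assoc : tr (x * y * z) = tr (x * (y * z)) := by
  obtain ⟨x₀, x₁, x₂, x₃, x₄, x₅, x₆, x₇, rfl⟩ := exists_eq_ofCoords x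
  obtain ⟨y₀, y₁, y₂, y₃, y₄, y₅, y₆, y₇, rfl⟩ := exists_eq_ofCoords y
  obtain ⟨z₀, z₁, z₂, z₃, z₄, z₅, z₆, z₇, rfl⟩ := exists_eq_ofCoords z
  simp only [mul_ofCoords, tr_ofCoords]
  ring

theorem tr_mul_conj_comm : tr (x * conj y) = tr (y * conj x) := by
  rw [← tr_conj, Octonion.conj_mul, conj_conj]

theorem tr_conj_mul_conj : tr (conj x * conj y) = tr (x * y) := by
  rw [← Octonion.conj_mul, tr_conj, tr_mul_comm]

theorem norm_add : norm (x + y) = norm x + tr (x * conj y) + norm y := by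
  obtain ⟨x₀, x₁, x₂, x₃, x₄, x₅, x₆, x₇, rfl⟩ := exists_eq_ofCoords x
  obtain ⟨y₀, y₁, y₂, y₃, y₄, y₅, y₆, y₇, rfl⟩ := exists_eq_ofCoords y
  simp only [add_ofCoords, mul_ofCoords, conj_ofCoords, tr_ofCoords, norm_ofCoords]
  ring

@[simp]
protected theorem norm_smul : norm (t • x) = t ^ 2 * norm x := by
  obtain ⟨x₀, x₁, x₂, x₃, x₄, x₅, x₆, x₇, rfl⟩ := exists_eq_ofCoords x
  simp only [smul_ofCoords, norm_ofCoords]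
  ring

@[simp]
protected theorem norm_mul : norm (x * y) = norm x * norm y := by
  obtain ⟨x₀, x₁, x₂, x₃, x₄, x₅, x₆, x₇, rfl⟩ := exists_eq_ofCoords x
  obtain ⟨y₀, y₁, y₂, y₃, y₄, y₅, y₆, y₇, rfl⟩ := exists_eq_ofCoords y
  simp only [mul_ofCoords, norm_ofCoords]
  ring

@[simp]
protected theorem norm_conj : norm (conj x) = norm x := by
  obtain ⟨x₀, x₁, x₂, x₃, x₄, x₅, x₆, x₇, rfl⟩ := exists_eq_ofCoords x
  simp only [conj_ofCoords, norm_ofCoords]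
  ring

@[simp]
protected theorem norm_one : norm (1 : Octonion k) = 1 := by
  simp only [one_eq_ofCoords, norm_ofCoords]
  ring

@[simp]
protected theorem norm_zero : norm (0 : Octonion k) = 0 := by
  simpa using Octonion.norm_smul (0 : Octonion k) 0

@[simp]
protected theorem norm_neg : norm (-x) = norm x := by
  simpa using Octonion.norm_smul x (-1)

@[simp]
theorem conj_mul_self : conj x * x = norm x • 1 := by
  simpa using mul_conj (conj x)

@[simp]
theorem mul_conj_mul : x * (conj x * y) = norm x • y := by
  obtain ⟨x₀, x₁, x₂, x₃, x₄, x₅, x₆, x₇, rfl⟩ := exists_eq_ofCoords x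
  obtain ⟨y₀, y₁, y₂, y₃, y₄, y₅, y₆, y₇, rfl⟩ := exists_eq_ofCoords y
  simp only [smul_ofCoords, mul_ofCoords, conj_ofCoords, norm_ofCoords, ofCoords_inj]
  refine ⟨?_, ?_, ?_, ?_, ?_, ?_, ?_, ?_⟩ <;> ring

@[simp]
theorem conj_mul_mul : conj x * (x * y) = norm x • y := by
  simpa using mul_conj_mul (conj x) y

@[simp]
theorem mul_mul_conj : y * x * conj x = norm x • y := by
  rw [← conj_conj (y * x * conj x)]
  simp only [Octonion.conj_mul _ (conj x), Octonion.conj_mul y, conj_conj x, mul_conj_mul,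
    conj_smul, conj_conj]

@[simp]
theorem mul_conj_mul_self : y * conj x * x = norm x • y := by
  simpa using mul_mul_conj (conj x) y

theorem mul_mul_self : x * y * x = tr (x * y) • x - norm x • conj y := by
  have h : x * y = tr (x * y) • 1 - conj y * conj x := by
    rw [← Octonion.conj_mul, conj_eq, sub_sub_cancel]
  rw [h, sub_mul, smul_mul_assoc, one_mul, mul_conj_mul_self, ← h]

theorem middle_moufang : b * x * (y * b) = b * (x * y) * b := by
  obtain ⟨x₀, x₁, x₂, x₃, x₄, x₅, x₆, x₇, rfl⟩ := exists_eq_ofCoords x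
  obtain ⟨y₀, y₁, y₂, y₃, y₄, y₅, y₆, y₇, rfl⟩ := exists_eq_ofCoords y
  obtain ⟨b₀, b₁, b₂, b₃, b₄, b₅, b₆, b₇, rfl⟩ := exists_eq_ofCoords b
  simp only [mul_ofCoords, ofCoords_inj]
  refine ⟨?_, ?_, ?_, ?_, ?_, ?_, ?_, ?_⟩ <;> ring

theorem conj_mul_mul_mul_mul_conj : conj b * (b * x * b) * conj b = norm b ^ 2 • x := by
  have h : conj b * conj x * conj b = tr (b * x) • conj b - norm b • x := by
    rw [mul_mul_self, tr_conj_mul_conj, Octonion.norm_conj, conj_conj]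
  rw [mul_mul_self b x, mul_sub, mul_smul_comm, conj_mul_self, mul_smul_comm, sub_mul,
    smul_mul_assoc, smul_mul_assoc, smul_mul_assoc, one_mul, h, smul_sub, smul_comm,
    sub_sub_cancel, smul_smul, sq]

theorem mul_conj_mul_mul_conj_mul : b * (conj b * x * conj b) * b = norm b ^ 2 • x := by
  simpa using conj_mul_mul_mul_mul_conj x (conj b)

theorem tr_mul_mul_mul_conj_mul_conj :
    tr (b * x * (y * b) * (conj b * z * conj b)) = norm b ^ 2 * tr (x * y * z) := by
  rw [middle_moufang, ← tr_mul_assoc, tr_mul_comm, ← tr_mul_assoc, ← tr_mul_assoc,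
    conj_mul_mul_mul_mul_conj, smul_mul_assoc, tr_smul]

end Composition

end Octonion

namespace Octonion

variable {k : Type*} [Field k]

theorem exists_tr_eq_norm_eq (t n : k) : ∃ a : Octonion k, tr a = t ∧ norm a = n :=
  ⟨ofCoords t (-n) 1 0 0 0 0 0, by simp [tr_ofCoords], by simp [norm_ofCoords]⟩

theorem exists_tr_mul_ne_zero {u : Octonion k} (hu : u ≠ 0) : ∃ x, tr (x * u) ≠ 0 := by
  obtain ⟨a, b, c, d, e, f, g, h, rfl⟩ := exists_eq_ofCoords u
  by_contra! H
  apply hu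
  have h₁ := H (ofCoords 1 0 0 0 0 0 0 0)
  have h₂ := H (ofCoords 0 0 1 0 0 0 0 0)
  have h₃ := H (ofCoords 0 1 0 0 0 0 0 0)
  have h₄ := H (ofCoords 0 0 0 1 0 0 0 0)
  have h₅ := H (ofCoords 0 0 0 0 0 0 0 1)
  have h₆ := H (ofCoords 0 0 0 0 0 0 1 0)
  have h₇ := H (ofCoords 0 0 0 0 0 1 0 0)
  have h₈ := H (ofCoords 0 0 0 0 1 0 0 0)
  simp only [mul_ofCoords, tr_ofCoords, zero_mul, mul_zero, one_mul, mul_one, add_zero, zero_add,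
    sub_zero, zero_sub, sub_self, neg_eq_zero] at h₁ h₂ h₃ h₄ h₅ h₆ h₇ h₈
  rw [zero_eq_ofCoords, ofCoords_inj]
  exact ⟨h₁, h₂, h₃, h₄, h₅, h₆, h₇, h₈⟩

theorem exists_tr_mul_eq {u : Octonion k} (hu : u ≠ 0) (c : k) : ∃ x, tr (x * u) = c := by
  obtain ⟨x, hx⟩ := exists_tr_mul_ne_zero hu
  exact ⟨(c / tr (x * u)) • x, by rw [smul_mul_assoc, tr_smul, div_mul_cancel₀ _ hx]⟩

theorem exists_tr_mul_ne_zero₂ {u v : Octonion k} (hu : u ≠ 0) (hv : v ≠ 0) :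
    ∃ x, tr (x * u) ≠ 0 ∧ tr (x * v) ≠ 0 := by
  obtain ⟨x, hx⟩ := exists_tr_mul_ne_zero hu
  obtain ⟨y, hy⟩ := exists_tr_mul_ne_zero hv
  by_cases hxv : tr (x * v) = 0
  · by_cases hyu : tr (y * u) = 0
    · exact ⟨x + y, by simpa [add_mul, hyu] using hx, by simpa [add_mul, hxv] using hy⟩
    · exact ⟨y, hyu, hy⟩
  · exact ⟨x, hx, hxv⟩

theorem mul_ne_zero_of_norm_ne_zero {e u : Octonion k} (he : norm e ≠ 0) (hu : u ≠ 0) :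
    e * u ≠ 0 := by
  intro h
  have hsmul := conj_mul_mul e u
  rw [h, mul_zero] at hsmul
  exact smul_ne_zero he hu hsmul.symm

/- Among three isotropic octonions with invertible pairwise sums at most one annihilates a given
nonzero octonion, so one of them annihilates neither `u` nor `v`. -/
theorem exists_norm_eq_zero_mul_ne_zero₂ {u v : Octonion k} (hu : u ≠ 0) (hv : v ≠ 0) :
    ∃ e, norm e = 0 ∧ e * u ≠ 0 ∧ e * v ≠ 0 := by
  have separate {e e' w : Octonion k} (he : norm (e + e') ≠ 0) (hw : w ≠ 0) (h : e * w = 0) :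
      e' * w ≠ 0 := fun h' =>
    mul_ne_zero_of_norm_ne_zero he hw (by rw [add_mul, h, h', add_zero])
  obtain ⟨e₁, e₂, e₃, n₁, n₂, n₃, n₁₂, n₁₃, n₂₃⟩ : ∃ e₁ e₂ e₃ : Octonion k,
      norm e₁ = 0 ∧ norm e₂ = 0 ∧ norm e₃ = 0 ∧ norm (e₁ + e₂) ≠ 0 ∧ norm (e₁ + e₃) ≠ 0 ∧
        norm (e₂ + e₃) ≠ 0 := by
    refine ⟨ofCoords 1 0 0 0 0 0 0 0, ofCoords 0 0 0 1 0 0 0 0, ofCoords 1 1 1 1 0 0 0 0, ?_⟩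
    norm_num [norm_ofCoords, add_ofCoords]
  by_contra! H
  by_cases hu₁ : e₁ * u = 0
  · exact separate n₂₃ hv (H e₂ n₂ (separate n₁₂ hu hu₁)) (H e₃ n₃ (separate n₁₃ hu hu₁))
  · have hv₁ := H e₁ n₁ hu₁
    have hu₂ : e₂ * u = 0 := not_not.1 fun h => separate n₁₂ hv hv₁ (H e₂ n₂ h)
    exact separate n₁₃ hv hv₁ (H e₃ n₃ (separate n₂₃ hu hu₂))

theorem exists_norm_eq_zero_tr_mul_ne_zero₂ {u v : Octonion k} (hu : u ≠ 0) (hv : v ≠ 0) :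
    ∃ b, norm b = 0 ∧ tr (b * u) ≠ 0 ∧ tr (b * v) ≠ 0 := by
  obtain ⟨e, he, heu, hev⟩ := exists_norm_eq_zero_mul_ne_zero₂ hu hv
  obtain ⟨x, hxu, hxv⟩ := exists_tr_mul_ne_zero₂ heu hev
  exact ⟨x * e, by rw [Octonion.norm_mul, he, mul_zero], by rwa [tr_mul_assoc],
    by rwa [tr_mul_assoc]⟩

theorem exists_tr_eq_zero_tr_mul_eq_zero_norm_ne_zero (h2 : (2 : k) ≠ 0) (r : Octonion k) :
    ∃ b, tr b = 0 ∧ tr (r * b) = 0 ∧ norm b ≠ 0 := by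
  by_contra! H
  set b₁ : Octonion k := ofCoords 0 0 0 0 1 0 0 (-1)
  set b₂ : Octonion k := ofCoords 0 0 0 0 0 1 1 0
  set b₃ : Octonion k := ofCoords 0 0 0 0 1 0 0 1
  have norm_combo (s₁ s₂ s₃ : k) :
      norm (s₁ • b₁ + s₂ • b₂ + s₃ • b₃) = s₁ ^ 2 + s₂ ^ 2 - s₃ ^ 2 := by
    simp only [b₁, b₂, b₃, smul_ofCoords, add_ofCoords, norm_ofCoords]
    ring
  have isotropic (s₁ s₂ s₃ : k)
      (h : s₁ * tr (r * b₁) + s₂ * tr (r * b₂) + s₃ * tr (r * b₃) = 0) :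
      s₁ ^ 2 + s₂ ^ 2 - s₃ ^ 2 = 0 := by
    rw [← norm_combo]
    refine H _ ?_ ?_
    · simp only [b₁, b₂, b₃, smul_ofCoords, add_ofCoords, tr_ofCoords]
      ring
    · simpa only [mul_add, mul_smul_comm, tr_add, tr_smul] using h
  have h₁₂ := isotropic (tr (r * b₂)) (-tr (r * b₁)) 0 (by ring)
  have h₁₃ := isotropic (tr (r * b₃)) 0 (-tr (r * b₁)) (by ring)
  have h₂₃ := isotropic 0 (tr (r * b₃)) (-tr (r * b₂)) (by ring)
  have hb₁ : tr (r * b₁) = 0 := by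
    refine pow_eq_zero_iff two_ne_zero |>.1 ((mul_eq_zero_iff_left h2).1 ?_)
    linear_combination h₁₂ - h₁₃ + h₂₃
  simpa using isotropic 1 0 0 (by rw [hb₁]; ring)

theorem eq_smul_one_of_tr_mul_eq_zero (h2 : (2 : k) ≠ 0) {z : Octonion k}
    (hz : ∀ a, tr a = 0 → tr (a * z) = 0) : z = (tr z / 2) • 1 := by
  by_contra! h
  obtain ⟨x, hx⟩ := exists_tr_mul_ne_zero (sub_ne_zero.2 h)
  apply hx
  have hx₀ := hz (x - (tr x / 2) • 1) (by simp [div_mul_cancel₀ _ h2])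
  simp only [sub_mul, smul_mul_assoc, one_mul, tr_sub, tr_smul] at hx₀
  simp only [mul_sub, mul_smul_comm, mul_one, tr_sub, tr_smul]
  linear_combination hx₀

end Octonion

section Generators

variable {k : Type*}

open Octonion

namespace J

/-- The Hermitian matrix with rows `(s₁, x₃, conj x₂)`, `(conj x₃, s₂, x₁)`, `(x₂, conj x₁, s₃)`. -/
def mk (s₁ s₂ s₃ : k) (x₁ x₂ x₃ : Octonion k) : J k := (![s₁, s₂, s₃], ![x₁, x₂, x₃])

theorem exists_eq_mk (X : J k) : ∃ s₁ s₂ s₃ x₁ x₂ x₃, X = mk s₁ s₂ s₃ x₁ x₂ x₃ :=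
  ⟨X.1 0, X.1 1, X.1 2, X.2 0, X.2 1, X.2 2, Prod.ext (List.ofFn_inj.1 rfl) (List.ofFn_inj.1 rfl)⟩

theorem mk_inj {s₁ s₂ s₃ t₁ t₂ t₃ : k} {x₁ x₂ x₃ y₁ y₂ y₃ : Octonion k} :
    mk s₁ s₂ s₃ x₁ x₂ x₃ = mk t₁ t₂ t₃ y₁ y₂ y₃ ↔
      (s₁ = t₁ ∧ s₂ = t₂ ∧ s₃ = t₃) ∧ x₁ = y₁ ∧ x₂ = y₂ ∧ x₃ = y₃ := by
  simp [mk]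

variable [Field k]

section

variable (s₁ s₂ s₃ t₁ t₂ t₃ c : k) (x₁ x₂ x₃ y₁ y₂ y₃ : Octonion k)

theorem mk_add_mk : mk s₁ s₂ s₃ x₁ x₂ x₃ + mk t₁ t₂ t₃ y₁ y₂ y₃ =
    mk (s₁ + t₁) (s₂ + t₂) (s₃ + t₃) (x₁ + y₁) (x₂ + y₂) (x₃ + y₃) := by
  simp [mk]

theorem smul_mk : c • mk s₁ s₂ s₃ x₁ x₂ x₃ =
    mk (c * s₁) (c * s₂) (c * s₃) (c • x₁) (c • x₂) (c • x₃) := by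
  simp [mk]

theorem mk_zero : mk 0 0 0 0 0 0 = (0 : J k) := by
  simp [mk]

theorem det_mk : det (mk s₁ s₂ s₃ x₁ x₂ x₃) =
    s₁ * s₂ * s₃ + tr (x₁ * x₂ * x₃) - s₁ * norm x₁ - s₂ * norm x₂ - s₃ * norm x₃ := rfl

end

/-- Adds `a` times the second row to the first row and the second column times `conj a` to the
first column. -/
def addRow₁₂ₗ (a : Octonion k) : J k →ₗ[k] J k where
  toFun X := mk (X.1 0 + tr (a * conj (X.2 2)) + norm a * X.1 1) (X.1 1) (X.1 2)
    (X.2 0) (X.2 1 + conj (X.2 0) * conj a) (X.2 2 + X.1 1 • a)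
  map_add' X Y := by
    rw [mk_add_mk, mk_inj]
    simp only [Prod.fst_add, Prod.snd_add, Pi.add_apply, conj_add, mul_add, add_mul, tr_add,
      add_smul]
    refine ⟨⟨?_, trivial, trivial⟩, trivial, ?_, ?_⟩
    · ring
    · abel
    · abel
  map_smul' c X := by
    rw [RingHom.id_apply, smul_mk, mk_inj]
    simp only [Prod.smul_fst, Prod.smul_snd, Pi.smul_apply, conj_smul, mul_smul_comm,
      smul_mul_assoc, tr_smul, smul_add, smul_smul, smul_eq_mul]
    refine ⟨⟨?_, trivial, trivial⟩, trivial, trivial, trivial⟩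
    ring

theorem addRow₁₂ₗ_mk (a : Octonion k) (s₁ s₂ s₃ : k) (x₁ x₂ x₃ : Octonion k) :
    addRow₁₂ₗ a (mk s₁ s₂ s₃ x₁ x₂ x₃) =
      mk (s₁ + tr (a * conj x₃) + norm a * s₂) s₂ s₃ x₁ (x₂ + conj x₁ * conj a) (x₃ + s₂ • a) :=
  rfl

theorem addRow₁₂ₗ_neg_addRow₁₂ₗ (a : Octonion k) (X : J k) :
    addRow₁₂ₗ (-a) (addRow₁₂ₗ a X) = X := by
  obtain ⟨s₁, s₂, s₃, x₁, x₂, x₃, rfl⟩ := exists_eq_mk X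
  rw [addRow₁₂ₗ_mk, addRow₁₂ₗ_mk, mk_inj]
  refine ⟨⟨?_, rfl, rfl⟩, rfl, by simp, by simp⟩
  simp only [conj_add, conj_smul, mul_add, mul_smul_comm, neg_mul, mul_conj, tr_add, tr_smul,
    tr_neg, Octonion.norm_neg, smul_neg, tr_one]
  ring

theorem det_addRow₁₂ₗ (a : Octonion k) (X : J k) : det (addRow₁₂ₗ a X) = det X := by
  obtain ⟨s₁, s₂, s₃, x₁, x₂, x₃, rfl⟩ := exists_eq_mk X
  have hcyc : tr (x₁ * x₂ * a) = tr (x₂ * (a * x₁)) := by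
    rw [tr_mul_assoc, tr_mul_comm, tr_mul_assoc]
  simp only [addRow₁₂ₗ_mk, det_mk, mul_add, add_mul, mul_conj_mul, norm_add, tr_add, tr_smul,
    smul_mul_assoc, mul_smul_comm, Octonion.norm_smul, Octonion.norm_mul, Octonion.norm_conj,
    Octonion.conj_mul, conj_smul, conj_conj, conj_mul_self, tr_one, hcyc, tr_mul_conj_comm a,
    tr_mul_comm (conj a)]
  ring

/-- The cyclic permutation of the rows and columns. -/
def rotateₗ : J k →ₗ[k] J k where
  toFun X := mk (X.1 1) (X.1 2) (X.1 0) (X.2 1) (X.2 2) (X.2 0)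
  map_add' _ _ := (mk_add_mk ..).symm
  map_smul' _ _ := (smul_mk ..).symm

theorem rotateₗ_mk (s₁ s₂ s₃ : k) (x₁ x₂ x₃ : Octonion k) :
    rotateₗ (mk s₁ s₂ s₃ x₁ x₂ x₃) = mk s₂ s₃ s₁ x₂ x₃ x₁ := rfl

theorem rotateₗ_injective : Function.Injective (rotateₗ (k := k)) :=
  Function.LeftInverse.injective (g := fun X => rotateₗ (rotateₗ X)) fun X => by
    obtain ⟨s₁, s₂, s₃, x₁, x₂, x₃, rfl⟩ := exists_eq_mk X
    rfl

theorem det_rotateₗ (X : J k) : det (rotateₗ X) = det X := by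
  obtain ⟨s₁, s₂, s₃, x₁, x₂, x₃, rfl⟩ := exists_eq_mk X
  rw [rotateₗ_mk, det_mk, det_mk, tr_mul_comm (x₂ * x₃), ← tr_mul_assoc]
  ring

/-- The transposition of the first two rows and columns. -/
def swapₗ : J k →ₗ[k] J k where
  toFun X := mk (X.1 1) (X.1 0) (X.1 2) (conj (X.2 1)) (conj (X.2 0)) (conj (X.2 2))
  map_add' _ _ := by simp [mk_add_mk]
  map_smul' _ _ := by simp [smul_mk]

theorem swapₗ_mk (s₁ s₂ s₃ : k) (x₁ x₂ x₃ : Octonion k) :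
    swapₗ (mk s₁ s₂ s₃ x₁ x₂ x₃) = mk s₂ s₁ s₃ (conj x₂) (conj x₁) (conj x₃) := rfl

theorem swapₗ_injective : Function.Injective (swapₗ (k := k)) :=
  Function.LeftInverse.injective (g := swapₗ) fun X => by
    obtain ⟨s₁, s₂, s₃, x₁, x₂, x₃, rfl⟩ := exists_eq_mk X
    simp only [swapₗ_mk, conj_conj]

theorem det_swapₗ (X : J k) : det (swapₗ X) = det X := by
  obtain ⟨s₁, s₂, s₃, x₁, x₂, x₃, rfl⟩ := exists_eq_mk X
  rw [swapₗ_mk, det_mk, det_mk, Octonion.norm_conj, Octonion.norm_conj, Octonion.norm_conj,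
    ← Octonion.conj_mul, tr_conj_mul_conj]
  ring

/-- The similitude of the determinant that multiplies the off-diagonal entries from the left, from
the right and from both sides. -/
def trialityₗ (b : Octonion k) : J k →ₗ[k] J k where
  toFun X := mk (norm b * X.1 0) (norm b * X.1 1) (X.1 2) (b * X.2 0) (X.2 1 * b)
    (conj b * X.2 2 * conj b)
  map_add' _ _ := by simp [mk_add_mk, mul_add, add_mul]
  map_smul' _ _ := by simp [smul_mk, mul_left_comm, mul_smul_comm, smul_mul_assoc]

theorem trialityₗ_mk (b : Octonion k) (s₁ s₂ s₃ : k) (x₁ x₂ x₃ : Octonion k) :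
    trialityₗ b (mk s₁ s₂ s₃ x₁ x₂ x₃) =
      mk (norm b * s₁) (norm b * s₂) s₃ (b * x₁) (x₂ * b) (conj b * x₃ * conj b) := rfl

theorem trialityₗ_injective {b : Octonion k} (hb : norm b ≠ 0) :
    Function.Injective (trialityₗ b) := by
  refine (injective_iff_map_eq_zero _).2 fun X hX => ?_
  obtain ⟨s₁, s₂, s₃, x₁, x₂, x₃, rfl⟩ := exists_eq_mk X
  rw [trialityₗ_mk, ← mk_zero, mk_inj] at hX
  obtain ⟨⟨hs₁, hs₂, hs₃⟩, hx₁, hx₂, hx₃⟩ := hX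
  have hx₁' := conj_mul_mul b x₁
  have hx₂' := mul_mul_conj b x₂
  have hx₃' := mul_conj_mul_mul_conj_mul x₃ b
  rw [hx₁, mul_zero, eq_comm, smul_eq_zero_iff_right hb] at hx₁'
  rw [hx₂, zero_mul, eq_comm, smul_eq_zero_iff_right hb] at hx₂'
  rw [hx₃, mul_zero, zero_mul, eq_comm, smul_eq_zero_iff_right (pow_ne_zero 2 hb)] at hx₃'
  rw [mul_eq_zero_iff_left hb] at hs₁ hs₂
  rw [hs₁, hs₂, hs₃, hx₁', hx₂', hx₃', mk_zero]

theorem det_trialityₗ (b : Octonion k) (X : J k) :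
    det (trialityₗ b X) = norm b ^ 2 * det X := by
  obtain ⟨s₁, s₂, s₃, x₁, x₂, x₃, rfl⟩ := exists_eq_mk X
  rw [trialityₗ_mk, det_mk, det_mk, tr_mul_mul_mul_conj_mul_conj]
  simp only [Octonion.norm_mul, Octonion.norm_conj]
  ring

end J

namespace GE6

open J

variable [Field k]

/-- The element of `GE₆(k)` given by an injective linear map that multiplies the determinant by a
nonzero scalar. -/
def ofInjective (f : J k →ₗ[k] J k) (hf : Function.Injective f) {c : k} (hc : c ≠ 0)
    (hdet : ∀ X, det (f X) = c * det X) : GE6 k :=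
  ⟨LinearEquiv.ofInjectiveEndo f hf, Units.mk0 c hc, hdet⟩

/-- `J.addRow₁₂ₗ` as an element of `GE₆(k)`. -/
def addRow₁₂ (a : Octonion k) : GE6 k :=
  ofInjective (addRow₁₂ₗ a) (Function.LeftInverse.injective (addRow₁₂ₗ_neg_addRow₁₂ₗ a)) one_ne_zero
    fun X => by rw [det_addRow₁₂ₗ, one_mul]

/-- `J.rotateₗ` as an element of `GE₆(k)`. -/
def rotate : GE6 k :=
  ofInjective rotateₗ rotateₗ_injective one_ne_zero fun X => by rw [det_rotateₗ, one_mul]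

/-- `J.swapₗ` as an element of `GE₆(k)`. -/
def swap : GE6 k :=
  ofInjective swapₗ swapₗ_injective one_ne_zero fun X => by rw [det_swapₗ, one_mul]

/-- `J.trialityₗ` as an element of `GE₆(k)`. -/
def triality (b : Octonion k) (hb : norm b ≠ 0) : GE6 k :=
  ofInjective (trialityₗ b) (trialityₗ_injective hb) (pow_ne_zero 2 hb) (det_trialityₗ b)

/-- Adds `a` times the first row to the second row. -/
def addRow₂₁ (a : Octonion k) : GE6 k := swap * addRow₁₂ a * swap

/-- Adds `a` times the third row to the second row. -/
def addRow₂₃ (a : Octonion k) : GE6 k := rotate * rotate * addRow₁₂ a * rotate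

/-- Adds `a` times the first row to the third row. -/
def addRow₃₁ (a : Octonion k) : GE6 k := rotate * addRow₁₂ a * rotate * rotate

/-- Adds `a` times the second row to the third row. -/
def addRow₃₂ (a : Octonion k) : GE6 k := rotate * rotate * addRow₂₁ a * rotate

/-- Adds `a` times the third row to the first row. -/
def addRow₁₃ (a : Octonion k) : GE6 k := rotate * addRow₂₁ a * rotate * rotate

variable (a b : Octonion k) (s₁ s₂ s₃ : k) (x₁ x₂ x₃ : Octonion k)

theorem rotate_smul_mk : (rotate : GE6 k) • mk s₁ s₂ s₃ x₁ x₂ x₃ = mk s₂ s₃ s₁ x₂ x₃ x₁ := rfl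

theorem swap_smul_mk : (swap : GE6 k) • mk s₁ s₂ s₃ x₁ x₂ x₃ =
    mk s₂ s₁ s₃ (conj x₂) (conj x₁) (conj x₃) := rfl

theorem triality_smul_mk (hb : norm b ≠ 0) : triality b hb • mk s₁ s₂ s₃ x₁ x₂ x₃ =
    mk (norm b * s₁) (norm b * s₂) s₃ (b * x₁) (x₂ * b) (conj b * x₃ * conj b) := rfl

theorem addRow₁₂_smul_mk : addRow₁₂ a • mk s₁ s₂ s₃ x₁ x₂ x₃ =
    mk (s₁ + tr (a * conj x₃) + norm a * s₂) s₂ s₃ x₁ (x₂ + conj x₁ * conj a) (x₃ + s₂ • a) :=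
  rfl

theorem addRow₂₁_smul_mk : addRow₂₁ a • mk s₁ s₂ s₃ x₁ x₂ x₃ =
    mk s₁ (s₂ + tr (a * x₃) + norm a * s₁) s₃ (x₁ + a * conj x₂) x₂ (x₃ + s₁ • conj a) := by
  simp [addRow₂₁, mul_smul, swap_smul_mk, addRow₁₂_smul_mk]

theorem addRow₂₃_smul_mk : addRow₂₃ a • mk s₁ s₂ s₃ x₁ x₂ x₃ =
    mk s₁ (s₂ + tr (a * conj x₁) + norm a * s₃) s₃ (x₁ + s₃ • a) x₂ (x₃ + conj x₂ * conj a) :=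
  rfl

theorem addRow₃₁_smul_mk : addRow₃₁ a • mk s₁ s₂ s₃ x₁ x₂ x₃ =
    mk s₁ s₂ (s₃ + tr (a * conj x₂) + norm a * s₁) (x₁ + conj x₃ * conj a) (x₂ + s₁ • a) x₃ :=
  rfl

theorem addRow₃₂_smul_mk : addRow₃₂ a • mk s₁ s₂ s₃ x₁ x₂ x₃ =
    mk s₁ s₂ (s₃ + tr (a * x₁) + norm a * s₂) (x₁ + s₂ • conj a) (x₂ + a * conj x₃) x₃ := by
  simp only [addRow₃₂, mul_smul, rotate_smul_mk, addRow₂₁_smul_mk]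

theorem addRow₁₃_smul_mk : addRow₁₃ a • mk s₁ s₂ s₃ x₁ x₂ x₃ =
    mk (s₁ + tr (a * x₂) + norm a * s₃) s₂ s₃ x₁ (x₂ + s₃ • conj a) (x₃ + a * conj x₁) := by
  simp only [addRow₁₃, mul_smul, rotate_smul_mk, addRow₂₁_smul_mk]

end GE6

end Generators

section BinaryCubic

variable {k : Type*} [Field k]

/-- The value at `(u, v)` of the binary cubic form with the coefficients of `P`. -/
def binaryForm (P : Cubic k) (u v : k) : k :=
  P.a * u ^ 3 + P.b * u ^ 2 * v + P.c * u * v ^ 2 + P.d * v ^ 3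

theorem binaryCubic_eq (h2 : (2 : k) ≠ 0) {M : Type*} [AddCommGroup M] [Module k M] {D : M → k}
    {x : Fin 2 → M} {P : Cubic k} (h : ∀ u v, D (u • x 0 + v • x 1) = binaryForm P u v) :
    binaryCubic D x = P := by
  have h₁₀ := h 1 0
  have h₀₁ := h 0 1
  have h₁₁ := h 1 1
  have h₁₂ := h 1 (-1)
  simp only [one_smul, zero_smul, neg_smul, add_zero, zero_add, ← sub_eq_add_neg, binaryForm]
    at h₁₀ h₀₁ h₁₁ h₁₂
  ext <;> simp only [binaryCubic, h₁₀, h₀₁, h₁₁, h₁₂] <;> field_simp <;> ring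

/-- The binary cubic form `(u, v) ↦ c * P((u, v) A)`. -/
def substForm (c : k) (A : Matrix (Fin 2) (Fin 2) k) (P : Cubic k) : Cubic k where
  a := c * binaryForm P (A 0 0) (A 0 1)
  b := c * (3 * P.a * A 0 0 ^ 2 * A 1 0 + P.b * (2 * A 0 0 * A 1 0 * A 0 1 + A 0 0 ^ 2 * A 1 1) +
    P.c * (A 1 0 * A 0 1 ^ 2 + 2 * A 0 0 * A 0 1 * A 1 1) + 3 * P.d * A 0 1 ^ 2 * A 1 1)
  c := c * (3 * P.a * A 0 0 * A 1 0 ^ 2 + P.b * (2 * A 0 0 * A 1 0 * A 1 1 + A 1 0 ^ 2 * A 0 1) +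
    P.c * (A 0 0 * A 1 1 ^ 2 + 2 * A 1 0 * A 0 1 * A 1 1) + 3 * P.d * A 0 1 * A 1 1 ^ 2)
  d := c * binaryForm P (A 1 0) (A 1 1)

theorem binaryForm_substForm (c : k) (A : Matrix (Fin 2) (Fin 2) k) (P : Cubic k) (u v : k) :
    binaryForm (substForm c A P) u v =
      c * binaryForm P (u * A 0 0 + v * A 1 0) (u * A 0 1 + v * A 1 1) := by
  simp only [binaryForm, substForm]
  ring

theorem discr_substForm (c : k) (A : Matrix (Fin 2) (Fin 2) k) (P : Cubic k) :
    (substForm c A P).discr = c ^ 4 * A.det ^ 6 * P.discr := by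
  simp only [substForm, binaryForm, Cubic.discr, Matrix.det_fin_two]
  ring

end BinaryCubic

section Pencils

variable {k : Type*} [Field k]

open Octonion

namespace J

/-- The derivative of the determinant at `X` in the direction `Y`. -/
def detDeriv (X Y : J k) : k :=
  Y.1 0 * X.1 1 * X.1 2 + X.1 0 * Y.1 1 * X.1 2 + X.1 0 * X.1 1 * Y.1 2 +
    tr (Y.2 0 * X.2 1 * X.2 2) + tr (X.2 0 * Y.2 1 * X.2 2) + tr (X.2 0 * X.2 1 * Y.2 2) -
    Y.1 0 * norm (X.2 0) - Y.1 1 * norm (X.2 1) - Y.1 2 * norm (X.2 2) -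
    X.1 0 * tr (X.2 0 * conj (Y.2 0)) - X.1 1 * tr (X.2 1 * conj (Y.2 1)) -
    X.1 2 * tr (X.2 2 * conj (Y.2 2))

theorem detDeriv_mk (s₁ s₂ s₃ t₁ t₂ t₃ : k) (x₁ x₂ x₃ y₁ y₂ y₃ : Octonion k) :
    detDeriv (mk s₁ s₂ s₃ x₁ x₂ x₃) (mk t₁ t₂ t₃ y₁ y₂ y₃) =
      t₁ * s₂ * s₃ + s₁ * t₂ * s₃ + s₁ * s₂ * t₃ + tr (y₁ * x₂ * x₃) + tr (x₁ * y₂ * x₃) +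
        tr (x₁ * x₂ * y₃) - t₁ * norm x₁ - t₂ * norm x₂ - t₃ * norm x₃ - s₁ * tr (x₁ * conj y₁) -
        s₂ * tr (x₂ * conj y₂) - s₃ * tr (x₃ * conj y₃) :=
  rfl

theorem det_smul_add_smul (X Y : J k) (u v : k) : det (u • X + v • Y) =
    binaryForm ⟨det X, detDeriv X Y, detDeriv Y X, det Y⟩ u v := by
  obtain ⟨s₁, s₂, s₃, x₁, x₂, x₃, rfl⟩ := exists_eq_mk X
  obtain ⟨t₁, t₂, t₃, y₁, y₂, y₃, rfl⟩ := exists_eq_mk Y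
  simp only [smul_mk, mk_add_mk, det_mk, detDeriv_mk, norm_add, Octonion.norm_smul, conj_smul,
    mul_smul_comm, smul_mul_assoc, tr_smul, mul_add, add_mul, tr_add, binaryForm,
    tr_mul_conj_comm x₁ y₁, tr_mul_conj_comm x₂ y₂, tr_mul_conj_comm x₃ y₃]
  ring

end J

theorem binaryCubic_det (h2 : (2 : k) ≠ 0) (x : V k) : binaryCubic J.det x =
    ⟨J.det (x 0), J.detDeriv (x 0) (x 1), J.detDeriv (x 1) (x 0), J.det (x 1)⟩ :=
  binaryCubic_eq h2 (J.det_smul_add_smul (x 0) (x 1))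

namespace TernaryForm

theorem toJ_add (A B : TernaryForm k) : toJ (A + B) = toJ A + toJ B := by
  refine Prod.ext rfl (funext fun i => ?_)
  fin_cases i <;> exact _root_.add_smul ..

theorem toJ_sub (A B : TernaryForm k) : toJ (A - B) = toJ A - toJ B := by
  refine Prod.ext rfl (funext fun i => ?_)
  fin_cases i <;> exact sub_smul ..

end TernaryForm

theorem toV_mem_Vss_iff (x : QPair k) : x.toV ∈ Vss k ↔ x ∈ QPairss k := by
  simp only [Vss, QPairss, Set.mem_ofPred_eq, binaryCubic, QPair.toV, ← TernaryForm.toJ_add,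
    ← TernaryForm.toJ_sub, TernaryForm.det_toJ]

/-- The points `x` and `y` are in the same orbit of `G`. -/
def SameOrbit (x y : V k) : Prop := y ∈ MulAction.orbit (G k) x

namespace SameOrbit

theorem trans {x y z : V k} (h : SameOrbit x y) (h' : SameOrbit y z) : SameOrbit x z := by
  obtain ⟨g, rfl⟩ := h
  obtain ⟨g', rfl⟩ := h'
  exact ⟨g' * g, mul_smul _ _ _⟩

theorem of_GE6 (h : GE6 k) (X Y : J k) : SameOrbit ![X, Y] ![h • X, h • Y] := by
  refine ⟨(h, 1), funext fun i => ?_⟩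
  change ∑ j, (1 : Matrix (Fin 2) (Fin 2) k) i j • h • ![X, Y] j = _
  fin_cases i <;> simp [Matrix.one_apply]

theorem of_GL (a b c d : k) (h : a * d - b * c ≠ 0) (X Y : J k) :
    SameOrbit ![X, Y] ![a • X + b • Y, c • X + d • Y] := by
  refine ⟨(1, Matrix.GeneralLinearGroup.mkOfDetNeZero !![a, b; c, d]
    (by rwa [Matrix.det_fin_two_of])), funext fun i => ?_⟩
  change ∑ j, !![a, b; c, d] i j • ![X, Y] j = _
  fin_cases i <;> simp

theorem add_smul (c : k) (X Y : J k) : SameOrbit ![X, Y] ![X, Y + c • X] := by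
  simpa [add_comm] using of_GL 1 0 c 1 (by simp) X Y

theorem smul_left {c : k} (h : c ≠ 0) (X Y : J k) : SameOrbit ![X, Y] ![c • X, Y] := by
  simpa using of_GL c 0 0 1 (by simpa) X Y

theorem smul_right {c : k} (h : c ≠ 0) (X Y : J k) : SameOrbit ![X, Y] ![X, c • Y] := by
  simpa using of_GL 1 0 0 c (by simpa) X Y

theorem mem_Vss (h2 : (2 : k) ≠ 0) {x y : V k} (h : SameOrbit x y) (hx : x ∈ Vss k) :
    y ∈ Vss k := by
  obtain ⟨⟨⟨g, c, hg⟩, A⟩, rfl⟩ := h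
  set y : V k := ((⟨g, c, hg⟩, A) : G k) • x
  have hyi (i) : y i = g (A.1 i 0 • x 0 + A.1 i 1 • x 1) := by
    rw [map_add, map_smul, map_smul]
    exact Fin.sum_univ_two _
  have hform : binaryCubic J.det y = substForm (c : k) A.1 (binaryCubic J.det x) := by
    refine binaryCubic_eq h2 fun u v => ?_
    rw [binaryForm_substForm, binaryCubic_det h2, ← J.det_smul_add_smul, ← hg, hyi, hyi,
      ← map_smul, ← map_smul, ← map_add]
    congr 2
    module
  rw [Vss, Set.mem_ofPred_eq, hform, discr_substForm]
  exact mul_ne_zero (mul_ne_zero (pow_ne_zero _ c.ne_zero) (pow_ne_zero _ A.det_ne_zero)) hx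

end SameOrbit

theorem exists_det_smul_add_smul_ne_zero {X Y : J k} (h : ![X, Y] ∈ Vss k) :
    ∃ a b : k, J.det (a • X + b • Y) ≠ 0 := by
  by_contra! hdet
  have h₁₀ := hdet 1 0
  have h₀₁ := hdet 0 1
  have h₁₁ := hdet 1 1
  have h₁₂ := hdet 1 (-1)
  simp only [one_smul, zero_smul, neg_smul, add_zero, zero_add, ← sub_eq_add_neg]
    at h₁₀ h₀₁ h₁₁ h₁₂
  exact h (by simp [binaryCubic, Cubic.discr, h₁₀, h₀₁, h₁₁, h₁₂])

theorem exists_sameOrbit_det_ne_zero {x : V k} (hx : x ∈ Vss k) :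
    ∃ X Y : J k, SameOrbit x ![X, Y] ∧ J.det X ≠ 0 := by
  obtain ⟨X, Y, rfl⟩ : ∃ X Y, x = ![X, Y] := ⟨x 0, x 1, List.ofFn_inj.1 rfl⟩
  obtain ⟨a, b, hab⟩ := exists_det_smul_add_smul_ne_zero hx
  by_cases ha : a = 0
  · have hb : b ≠ 0 := by
      rintro rfl
      simp [ha, J.det, tr_zero] at hab
    exact ⟨_, _, .of_GL a b 1 0 (by simpa [ha]) X Y, hab⟩
  · exact ⟨_, _, .of_GL a b 0 1 (by simpa) X Y, hab⟩

end Pencils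

section IsotropicRow

variable {k : Type*} [Field k]

open Octonion J GE6

namespace J

variable (k) in
/-- The representative of the nonsingular orbit with which the first entry of a pair is
normalized. -/
def base : J k := mk 0 0 1 0 0 1

theorem det_smul_ne_zero {X : J k} (hX : det X ≠ 0) (g : GE6 k) : det (g • X) ≠ 0 := by
  obtain ⟨g, c, hg⟩ := g
  exact (hg X).trans_ne (mul_ne_zero c.ne_zero hX)

theorem exists_smul_eq_mk_ne_zero {X : J k} (hX : det X ≠ 0) :
    ∃ (h : GE6 k) (s₁ s₂ s₃ : k) (x₁ x₂ x₃ : Octonion k), s₃ ≠ 0 ∧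
      h • X = mk s₁ s₂ s₃ x₁ x₂ x₃ := by
  obtain ⟨s₁, s₂, s₃, x₁, x₂, x₃, rfl⟩ := exists_eq_mk X
  by_cases h₃ : s₃ = 0
  swap; · exact ⟨1, _, _, _, _, _, _, h₃, one_smul _ _⟩
  by_cases h₁ : s₁ = 0
  swap; · exact ⟨rotate, _, _, _, _, _, _, h₁, rotate_smul_mk ..⟩
  by_cases hx : x₂ = 0
  · have h₂ : s₂ ≠ 0 := by
      rintro rfl
      simp [det_mk, h₁, h₃, hx] at hX
    exact ⟨rotate * rotate, _, _, _, _, _, _, h₂,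
      by rw [mul_smul, rotate_smul_mk, rotate_smul_mk]⟩
  · obtain ⟨a, ha⟩ := exists_tr_mul_ne_zero hx
    refine ⟨rotate * addRow₁₃ a, _, _, _, _, _, _, ?_,
      by rw [mul_smul, addRow₁₃_smul_mk, rotate_smul_mk]⟩
    simpa [h₁, h₃] using ha

theorem exists_smul_mk_eq_block (s₁ s₂ : k) {s₃ : k} (h₃ : s₃ ≠ 0) (x₁ x₂ x₃ : Octonion k) :
    ∃ (h : GE6 k) (t₁ t₂ : k) (y : Octonion k),
      h • mk s₁ s₂ s₃ x₁ x₂ x₃ = mk t₁ t₂ s₃ 0 0 y := by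
  refine ⟨addRow₂₃ (-(s₃⁻¹ • x₁)) * addRow₁₃ (-(s₃⁻¹ • conj x₂)), ?_⟩
  simp only [mul_smul, addRow₁₃_smul_mk, addRow₂₃_smul_mk, conj_neg, conj_smul, conj_conj, smul_neg,
    smul_inv_smul₀ h₃, add_neg_cancel]
  exact ⟨_, _, _, rfl⟩

theorem exists_smul_block_eq_mk_zero_left {s₁ s₂ : k} (s₃ : k) {x : Octonion k}
    (hx : norm x - s₁ * s₂ ≠ 0) :
    ∃ (h : GE6 k) (t : k) (y : Octonion k), norm y ≠ 0 ∧
      h • mk s₁ s₂ s₃ 0 0 x = mk 0 t s₃ 0 0 y := by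
  by_cases h₂ : s₂ = 0
  · have hx₀ : conj x ≠ 0 := fun h => hx <| by
      rw [← Octonion.norm_conj, h, Octonion.norm_zero, h₂, mul_zero, sub_zero]
    obtain ⟨a, ha⟩ := exists_tr_mul_eq hx₀ (-s₁)
    exact ⟨addRow₁₂ a, 0, x, by simpa [h₂] using hx, by simp [addRow₁₂_smul_mk, ha, h₂]⟩
  · obtain ⟨w, -, hw⟩ := exists_tr_eq_norm_eq 0 (norm x - s₁ * s₂)
    refine ⟨addRow₁₂ (s₂⁻¹ • (w - x)), s₂, w, hw ▸ hx, ?_⟩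
    rw [addRow₁₂_smul_mk, mk_inj, smul_inv_smul₀ h₂, sub_eq_add_neg, smul_mul_assoc,
      Octonion.norm_smul, norm_add, add_mul, neg_mul, mul_conj]
    refine ⟨⟨?_, rfl, rfl⟩, rfl, by simp, by abel⟩
    simp only [tr_smul, tr_add, tr_neg, conj_neg, mul_neg, tr_one, hw, Octonion.norm_neg]
    field

theorem exists_smul_block_eq_smul_base {s₃ : k} (h₃ : s₃ ≠ 0) {y : Octonion k} (hy : norm y ≠ 0) :
    ∃ h : GE6 k, h • mk 0 0 s₃ 0 0 y = (s₃⁻¹ * norm y) • base k := by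
  refine ⟨rotate * triality (s₃⁻¹ • conj y) ?_ * rotate * rotate, ?_⟩
  · simp [Octonion.norm_smul, h₃, hy]
  · simp only [mul_smul, rotate_smul_mk, triality_smul_mk]
    simp only [base, smul_mk, mk_inj,
      Octonion.norm_smul, Octonion.norm_conj, smul_mul_assoc, conj_mul_self, smul_smul]
    refine ⟨⟨by simp, by simp, ?_⟩, by simp, by simp, trivial⟩
    field

theorem exists_smul_eq_smul_base {X : J k} (hX : det X ≠ 0) :
    ∃ (h : GE6 k) (c : k), c ≠ 0 ∧ h • X = c • base k := by
  obtain ⟨g₁, s₁, s₂, s₃, x₁, x₂, x₃, h₃, e₁⟩ := exists_smul_eq_mk_ne_zero hX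
  obtain ⟨g₂, t₁, t₂, x, e₂⟩ := exists_smul_mk_eq_block s₁ s₂ h₃ x₁ x₂ x₃
  have hx : norm x - t₁ * t₂ ≠ 0 := fun h => by
    apply det_smul_ne_zero (det_smul_ne_zero hX g₁) g₂
    rw [e₁, e₂, det_mk]
    simp only [mul_zero, zero_mul, tr_zero, Octonion.norm_zero]
    linear_combination -s₃ * h
  obtain ⟨g₃, t, y, hy, e₃⟩ := exists_smul_block_eq_mk_zero_left s₃ hx
  obtain ⟨a, ha⟩ := exists_tr_mul_eq (u := y) (fun h => hy (h ▸ Octonion.norm_zero)) (-t)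
  have e₄ : addRow₂₁ a • mk 0 t s₃ 0 0 y = mk 0 0 s₃ 0 0 y := by
    simp [addRow₂₁_smul_mk, ha]
  obtain ⟨g₅, e₅⟩ := exists_smul_block_eq_smul_base h₃ hy
  exact ⟨g₅ * addRow₂₁ a * g₃ * g₂ * g₁, _, mul_ne_zero (inv_ne_zero h₃) hy,
    by simp only [mul_smul, e₁, e₂, e₃, e₄, e₅]⟩

end J

theorem sameOrbit_base_add_smul (s₁ s₂ s₃ : k) (x₁ x₂ x₃ : Octonion k) :
    SameOrbit ![base k, mk s₁ s₂ s₃ x₁ x₂ x₃] ![base k, mk s₁ s₂ 0 x₁ x₂ (x₃ - s₃ • 1)] := by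
  convert SameOrbit.add_smul (-s₃) (base k) (mk s₁ s₂ s₃ x₁ x₂ x₃) using 3
  rw [base, smul_mk, mk_add_mk]
  simp [sub_eq_add_neg]

theorem exists_sameOrbit_base {x : V k} (hx : x ∈ Vss k) :
    ∃ (s₁ s₂ : k) (x₁ x₂ x₃ : Octonion k), SameOrbit x ![base k, mk s₁ s₂ 0 x₁ x₂ x₃] := by
  obtain ⟨X, Y, hXY, hX⟩ := exists_sameOrbit_det_ne_zero hx
  obtain ⟨h, c, hc, e⟩ := exists_smul_eq_smul_base hX
  obtain ⟨s₁, s₂, s₃, x₁, x₂, x₃, e'⟩ := exists_eq_mk (h • Y)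
  have hbase := (SameOrbit.of_GE6 h X Y).trans (.smul_left (inv_ne_zero hc) _ _)
  rw [e, e', inv_smul_smul₀ hc] at hbase
  exact ⟨_, _, _, _, _, hXY.trans (hbase.trans (sameOrbit_base_add_smul ..))⟩

theorem sameOrbit_swap (s₁ s₂ : k) (x₁ x₂ x₃ : Octonion k) :
    SameOrbit ![base k, mk s₁ s₂ 0 x₁ x₂ x₃]
      ![base k, mk s₂ s₁ 0 (conj x₂) (conj x₁) (conj x₃)] := by
  simpa [base, swap_smul_mk] using SameOrbit.of_GE6 swap (base k) (mk s₁ s₂ 0 x₁ x₂ x₃)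

/- The product `addRow₃₂ (-conj b) * addRow₁₃ b * addRow₁₂ a` fixes `base` exactly when
`tr a + norm b = 0`. -/
theorem sameOrbit_unipotent (s₁ s₂ : k) (x₁ x₂ x₃ : Octonion k) {a b : Octonion k}
    (hab : tr a + norm b = 0) :
    SameOrbit ![base k, mk s₁ s₂ 0 x₁ x₂ x₃] ![base k,
      mk (s₁ + tr (a * conj x₃) + norm a * s₂ + tr (b * (x₂ + conj x₁ * conj a))) s₂ 0
        (x₁ - s₂ • b) (x₂ + conj x₁ * conj a - conj b * conj (x₃ + s₂ • a + b * conj x₁))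
        (x₃ + s₂ • a + b * conj x₁ - (norm b * s₂ - tr (conj b * x₁)) • 1)] := by
  set g : GE6 k := addRow₃₂ (-conj b) * addRow₁₃ b * addRow₁₂ a with hg
  have hbase : g • base k = base k := by
    simp [hg, mul_smul, base, addRow₁₂_smul_mk, addRow₁₃_smul_mk, addRow₃₂_smul_mk, hab]
  have hmk := SameOrbit.of_GE6 g (base k) (mk s₁ s₂ 0 x₁ x₂ x₃)
  rw [hbase] at hmk
  refine hmk.trans ?_
  rw [hg, mul_smul, mul_smul, addRow₁₂_smul_mk, addRow₁₃_smul_mk, addRow₃₂_smul_mk]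
  convert sameOrbit_base_add_smul .. using 3
  rw [mk_inj]
  simp [sub_eq_add_neg, add_comm (norm b * s₂)]

theorem ne_zero_of_base_block_mem_Vss (h2 : (2 : k) ≠ 0) {s₁ s₂ ρ : k}
    (h : ![base k, mk s₁ s₂ 0 0 0 (ρ • 1)] ∈ Vss k) :
    s₁ ≠ 0 ∧ s₂ ≠ 0 ∧ ρ ^ 2 - s₁ * s₂ ≠ 0 := by
  have hdiscr : 4 * s₁ * s₂ * (ρ ^ 2 - s₁ * s₂) ^ 2 ≠ 0 := by
    rw [Vss, Set.mem_ofPred_eq, binaryCubic_det h2] at h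
    convert h using 1
    simp only [Cubic.discr, Matrix.cons_val_zero, Matrix.cons_val_one, base, det_mk, detDeriv_mk,
      mul_zero, zero_mul, conj_smul, conj_one, smul_mul_assoc, mul_smul_comm, one_mul, tr_smul,
      tr_one, tr_zero, Octonion.norm_zero, Octonion.norm_smul, Octonion.norm_one]
    ring
  simp only [mul_ne_zero_iff, pow_ne_zero_iff two_ne_zero] at hdiscr
  exact ⟨hdiscr.1.1.2, hdiscr.1.2, hdiscr.2⟩

theorem exists_sameOrbit_s₂_ne_zero (h2 : (2 : k) ≠ 0) {x : V k} (hx : x ∈ Vss k) :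
    ∃ (s₁ s₂ : k) (x₁ x₂ x₃ : Octonion k), s₂ ≠ 0 ∧
      SameOrbit x ![base k, mk s₁ s₂ 0 x₁ x₂ x₃] := by
  by_contra! H
  have hs₂ {s₁ s₂ x₁ x₂ x₃} (h : SameOrbit x ![base k, mk s₁ s₂ 0 x₁ x₂ x₃]) : s₂ = 0 :=
    not_not.1 fun h₀ => H _ _ _ _ _ h₀ h
  have hs₁ {s₁ s₂ x₁ x₂ x₃} (h : SameOrbit x ![base k, mk s₁ s₂ 0 x₁ x₂ x₃]) : s₁ = 0 :=
    hs₂ (h.trans (sameOrbit_swap ..))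
  have hx₂ {s₁ s₂ x₁ x₂ x₃} (h : SameOrbit x ![base k, mk s₁ s₂ 0 x₁ x₂ x₃]) : x₂ = 0 := by
    by_contra hne
    obtain ⟨b, hb, hbx, -⟩ := exists_norm_eq_zero_tr_mul_ne_zero₂ hne hne
    have hb₁ := hs₁ (h.trans (sameOrbit_unipotent s₁ s₂ x₁ x₂ x₃ (a := 0) (by simpa)))
    exact hbx (by simpa [hs₁ h] using hb₁)
  obtain ⟨s₁, s₂, x₁, x₂, x₃, h⟩ := exists_sameOrbit_base hx
  have hx₁ : conj x₁ = 0 := hx₂ (h.trans (sameOrbit_swap ..))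
  have hx₃ := eq_smul_one_of_tr_mul_eq_zero h2 (z := conj x₃) fun a ha => by
    have ha₁ := hs₁ (h.trans (sameOrbit_unipotent s₁ s₂ x₁ x₂ x₃ (b := 0) (by simpa)))
    simpa [hs₁ h, hs₂ h] using ha₁
  have hmem := SameOrbit.mem_Vss h2 (h.trans (sameOrbit_swap ..)) hx
  rw [hx₁, hx₂ h, conj_zero, hx₃] at hmem
  exact (ne_zero_of_base_block_mem_Vss h2 hmem).1 (hs₂ h)

theorem exists_sameOrbit_x₁_eq_zero_x₃_eq_smul_one (h2 : (2 : k) ≠ 0) (s₁ : k) {s₂ : k}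
    (h₂ : s₂ ≠ 0) (x₁ x₂ x₃ : Octonion k) :
    ∃ (t ρ : k) (y : Octonion k),
      SameOrbit ![base k, mk s₁ s₂ 0 x₁ x₂ x₃] ![base k, mk t s₂ 0 0 y (ρ • 1)] := by
  set b : Octonion k := s₂⁻¹ • x₁ with hb
  set a : Octonion k := s₂⁻¹ • ((tr x₃ / 2) • 1 - x₃) - (norm b / 2) • 1 with ha
  have hab : tr a + norm b = 0 := by
    simp only [ha, tr_sub, tr_smul, tr_one]
    field
  have hx₁ : x₁ - s₂ • b = 0 := by rw [hb, smul_inv_smul₀ h₂, sub_self]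
  have hx₃ : x₃ + s₂ • a + b * conj x₁ =
      (tr x₃ / 2 - s₂ * (norm b / 2) + s₂⁻¹ * norm x₁) • (1 : Octonion k) := by
    rw [ha, smul_sub, smul_inv_smul₀ h₂, hb, smul_mul_assoc, mul_conj]
    module
  have horbit := sameOrbit_unipotent s₁ s₂ x₁ x₂ x₃ hab
  rw [hx₁, hx₃, ← sub_smul] at horbit
  exact ⟨_, _, _, horbit⟩

/-- The orbit of `x` contains a pair `(base, Y)` such that the first diagonal entry of `Y` vanishes
and the corner entry `x₂` of `Y` is invertible. -/
def HasIsotropicRow (x : V k) : Prop :=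
  ∃ (s₂ : k) (x₁ x₂ x₃ : Octonion k), norm x₂ ≠ 0 ∧ SameOrbit x ![base k, mk 0 s₂ 0 x₁ x₂ x₃]

theorem SameOrbit.hasIsotropicRow {x y : V k} (h : SameOrbit x y) (hy : HasIsotropicRow y) :
    HasIsotropicRow x := by
  obtain ⟨s₂, x₁, x₂, x₃, hx₂, hy⟩ := hy
  exact ⟨s₂, x₁, x₂, x₃, hx₂, h.trans hy⟩

theorem hasIsotropicRow_of_unipotent {s₁ s₂ ρ : k} {y a b : Octonion k} (hab : tr a + norm b = 0)
    (hs : s₁ + ρ * tr a + norm a * s₂ + tr (b * y) = 0)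
    (hy : Octonion.norm (y - conj b * conj (ρ • 1 + s₂ • a)) ≠ 0) :
    HasIsotropicRow ![base k, mk s₁ s₂ 0 0 y (ρ • 1)] := by
  have horbit := sameOrbit_unipotent s₁ s₂ 0 y (ρ • 1) hab
  simp only [conj_zero, zero_mul, mul_zero, add_zero, conj_smul, conj_one, mul_smul_comm, mul_one,
    tr_smul, hs] at horbit
  exact ⟨_, _, _, _, hy, horbit⟩

theorem norm_smul_one_add_smul (ρ s : k) (a : Octonion k) :
    norm (ρ • 1 + s • a) = ρ ^ 2 + ρ * s * tr a + s ^ 2 * norm a := by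
  rw [Octonion.norm_add, Octonion.norm_smul, Octonion.norm_smul, Octonion.norm_one, conj_smul,
    smul_mul_assoc, mul_smul_comm, one_mul, tr_smul, tr_smul, tr_conj]
  ring

theorem hasIsotropicRow_of_eq_zero (h2 : (2 : k) ≠ 0) {s₁ s₂ ρ : k}
    (h : ![base k, mk s₁ s₂ 0 0 0 (ρ • 1)] ∈ Vss k) :
    HasIsotropicRow ![base k, mk s₁ s₂ 0 0 0 (ρ • 1)] := by
  obtain ⟨-, h₂, hρ⟩ := ne_zero_of_base_block_mem_Vss h2 h
  obtain ⟨a, hta, hna⟩ := exists_tr_eq_norm_eq (-1) ((ρ - s₁) / s₂)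
  refine hasIsotropicRow_of_unipotent (a := a) (b := 1) ?_ ?_ ?_
  · rw [hta, Octonion.norm_one, neg_add_cancel]
  · rw [hta, hna, mul_zero, tr_zero]
    field
  · rw [conj_one, one_mul, zero_sub, Octonion.norm_neg, Octonion.norm_conj, norm_smul_one_add_smul,
      hta, hna]
    convert hρ using 1
    field

theorem hasIsotropicRow_of_norm_ne_zero {s₁ s₂ : k} (h₂ : s₂ ≠ 0) (ρ : k) {y : Octonion k}
    (hy : norm y ≠ 0) : HasIsotropicRow ![base k, mk s₁ s₂ 0 0 y (ρ • 1)] := by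
  obtain ⟨a, hta, hna⟩ := exists_tr_eq_norm_eq 0 (-s₁ / s₂)
  refine hasIsotropicRow_of_unipotent (a := a) (b := 0) (by simp [hta]) ?_ (by simpa)
  rw [hta, hna, zero_mul, tr_zero]
  field

theorem exists_add_mul_ne_zero₂ (h2 : (2 : k) ≠ 0) (p q : k) {s t : k} (hs : s ≠ 0) (ht : t ≠ 0) :
    ∃ n, p + s * n ≠ 0 ∧ q + t * n ≠ 0 := by
  by_contra! H
  have hprod (n : k) : (p + s * n) * (q + t * n) = 0 :=
    mul_eq_zero.2 (or_iff_not_imp_left.2 (H n))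
  refine mul_ne_zero (mul_ne_zero h2 hs) ht ?_
  linear_combination hprod 1 + hprod (-1) - 2 * hprod 0

theorem hasIsotropicRow_of_norm_eq_zero (h2 : (2 : k) ≠ 0) (s₁ : k) {s₂ : k} (h₂ : s₂ ≠ 0) (ρ : k)
    {y : Octonion k} (hy : y ≠ 0) (hy₀ : norm y = 0) :
    HasIsotropicRow ![base k, mk s₁ s₂ 0 0 y (ρ • 1)] := by
  obtain ⟨n, hn, hρn⟩ := exists_add_mul_ne_zero₂ h2 s₁ (ρ ^ 2) h₂ (pow_ne_zero 2 h₂)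
  obtain ⟨a, hta, hna⟩ := exists_tr_eq_norm_eq 0 n
  set w : Octonion k := ρ • 1 + s₂ • a with hw
  have hnw : norm w ≠ 0 := by rwa [hw, norm_smul_one_add_smul, hta, hna, mul_zero, add_zero]
  have hyw : y * w ≠ 0 := fun h => smul_ne_zero hnw hy <| by
    rw [← mul_mul_conj, h, zero_mul]
  obtain ⟨b, hb, hby, hbyw⟩ := exists_norm_eq_zero_tr_mul_ne_zero₂ hy hyw
  refine hasIsotropicRow_of_unipotent (a := a) (b := (-(s₁ + s₂ * n) / tr (b * y)) • b) ?_ ?_ ?_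
  · rw [hta, Octonion.norm_smul, hb, mul_zero, add_zero]
  · rw [hta, hna, smul_mul_assoc, tr_smul, div_mul_cancel₀ _ hby]
    ring
  · rw [← hw, ← Octonion.conj_mul, sub_eq_add_neg, norm_add, Octonion.norm_neg,
      Octonion.norm_conj, conj_neg, conj_conj, Octonion.norm_mul, Octonion.norm_smul, hb, hy₀,
      mul_neg, mul_smul_comm, mul_smul_comm, tr_neg, tr_smul, ← tr_mul_assoc, tr_mul_comm _ b]
    simp only [mul_zero, add_zero, zero_add]
    exact neg_ne_zero.2 (mul_ne_zero (div_ne_zero (neg_ne_zero.2 hn) hby) hbyw)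

theorem hasIsotropicRow_of_mem_Vss (h2 : (2 : k) ≠ 0) {x : V k} (hx : x ∈ Vss k) :
    HasIsotropicRow x := by
  obtain ⟨s₁, s₂, x₁, x₂, x₃, h₂, hx'⟩ := exists_sameOrbit_s₂_ne_zero h2 hx
  obtain ⟨t, ρ, y, hy⟩ := exists_sameOrbit_x₁_eq_zero_x₃_eq_smul_one h2 s₁ h₂ x₁ x₂ x₃
  have horbit := hx'.trans hy
  refine horbit.hasIsotropicRow ?_
  by_cases hy₀ : y = 0
  · subst hy₀
    exact hasIsotropicRow_of_eq_zero h2 (horbit.mem_Vss h2 hx)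
  by_cases hny : norm y = 0
  · exact hasIsotropicRow_of_norm_eq_zero h2 t h₂ ρ hy₀ hny
  · exact hasIsotropicRow_of_norm_ne_zero h₂ ρ hny

end IsotropicRow

section SymmetricRepresentative

variable {k : Type*} [Field k]

open Octonion J GE6

theorem Octonion.mul_self_of_tr_eq_zero {b : Octonion k} (hb : tr b = 0) :
    b * b = -norm b • 1 := by
  have hconj : conj b = -b := by rw [conj_eq, hb, zero_smul, zero_sub]
  rw [neg_smul, ← mul_conj, hconj, mul_neg, neg_neg]

/-- The product of two trialities which multiplies the entry `x₂` on the right by a multiple of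
`conj b` and the entry `x₃` on both sides by `b`. -/
def GE6.twist (b : Octonion k) (hb : norm b ≠ 0) : GE6 k :=
  rotate * triality b hb * rotate * triality b hb * rotate

theorem GE6.twist_smul_mk {b : Octonion k} (hb : norm b ≠ 0) (s₁ s₂ s₃ : k)
    (x₁ x₂ x₃ : Octonion k) : twist b hb • mk s₁ s₂ s₃ x₁ x₂ x₃ =
      mk (norm b * s₁) (norm b * s₂) (norm b ^ 2 * s₃)
        (conj b * x₁ * conj b * b) (norm b • (x₂ * conj b)) (b * (x₃ * b)) := by
  simp only [twist, mul_smul, rotate_smul_mk, triality_smul_mk, conj_mul_mul, smul_mul_assoc,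
    sq, mul_assoc (norm b)]

theorem exists_sameOrbit_x₂_eq_smul_one (h2 : (2 : k) ≠ 0) {u : Octonion k} (hu : norm u ≠ 0)
    (s s' t' : k) {t : k} (ht : t ≠ 0) (y y' : Octonion k) :
    ∃ (r v r' v' κ l : k) (z z' : Octonion k), v ≠ 0 ∧ κ ≠ 0 ∧ l ≠ 0 ∧
      SameOrbit ![mk 0 s t y 0 1, mk 0 s' t' y' u 0]
        ![mk 0 r v z 0 (κ • 1), mk 0 r' v' z' (l • 1) 0] := by
  obtain ⟨b, hb, hub, hnb⟩ := exists_tr_eq_zero_tr_mul_eq_zero_norm_ne_zero h2 u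
  set c : Octonion k := u * conj b with hc
  have htc : tr c = 0 := by
    rw [hc, conj_eq, hb, zero_smul, zero_sub, mul_neg, tr_neg, neg_eq_zero]
    exact hub
  have hnc : norm c ≠ 0 := by
    rw [hc, Octonion.norm_mul, Octonion.norm_conj]
    exact mul_ne_zero hu hnb
  have horbit := SameOrbit.of_GE6 (twist c hnc * twist b hnb) (mk 0 s t y 0 1) (mk 0 s' t' y' u 0)
  simp only [mul_smul (twist c hnc), twist_smul_mk, mul_zero, zero_mul, smul_zero, one_mul, ← hc,
    mul_self_of_tr_eq_zero hb, mul_self_of_tr_eq_zero htc, smul_mul_assoc, mul_smul_comm,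
    mul_conj, smul_smul] at horbit
  refine ⟨_, _, _, _, _, _, _, _, ?_, ?_, ?_, horbit⟩
  · exact mul_ne_zero (pow_ne_zero 2 hnc) (mul_ne_zero (pow_ne_zero 2 hnb) ht)
  · exact mul_ne_zero (neg_ne_zero.2 hnb) (neg_ne_zero.2 hnc)
  · exact mul_ne_zero hnc (mul_ne_zero hnb hnc)

theorem exists_sameOrbit_x₁_eq_zero (s s' t t' : k) (y y' : Octonion k) :
    ∃ r r' v' : k, SameOrbit ![mk 0 s t y 0 1, mk 0 s' t' y' 1 0]
      ![mk 0 r t 0 0 1, mk 0 r' v' 0 1 0] := by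
  have horbit := SameOrbit.of_GE6 (addRow₃₁ (conj (-y)) * addRow₂₁ (-y'))
    (mk 0 s t y 0 1) (mk 0 s' t' y' 1 0)
  simp only [mul_smul, addRow₂₁_smul_mk, addRow₃₁_smul_mk, conj_neg, conj_zero, conj_one,
    conj_conj, tr_zero, mul_zero, zero_mul, mul_one, one_mul, smul_neg, zero_smul, neg_zero,
    add_zero, add_neg_cancel] at horbit
  exact ⟨_, _, _, horbit⟩

theorem HasIsotropicRow.exists_sameOrbit (h2 : (2 : k) ≠ 0) {x : V k} (hx : HasIsotropicRow x) :
    ∃ s t s' t' : k, t ≠ 0 ∧ SameOrbit x ![mk 0 s t 0 0 1, mk 0 s' t' 0 1 0] := by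
  obtain ⟨s₂, x₁, x₂, x₃, hx₂, hrow⟩ := hx
  have hx₃ : x₃ + conj x₂ * conj (conj (-((norm x₂)⁻¹ • (x₂ * x₃)))) = 0 := by
    rw [conj_conj, mul_neg, mul_smul_comm, conj_mul_mul, inv_smul_smul₀ hx₂, add_neg_cancel]
  have hclear := hrow.trans (SameOrbit.of_GE6 (addRow₂₃ (conj (-((norm x₂)⁻¹ • (x₂ * x₃))))) _ _)
  rw [base, addRow₂₃_smul_mk, addRow₂₃_smul_mk, hx₃, conj_zero, zero_mul, add_zero] at hclear
  obtain ⟨r, t, r', t', κ, l, z, z', ht, hκ, hl, hscalar⟩ :=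
    exists_sameOrbit_x₂_eq_smul_one h2 hx₂ _ _ _ one_ne_zero _ _
  have hone := (hscalar.trans (.smul_left (inv_ne_zero hκ) _ _)).trans
    (.smul_right (inv_ne_zero hl) _ _)
  simp only [smul_mk, inv_smul_smul₀ hκ, inv_smul_smul₀ hl, smul_zero, mul_zero] at hone
  obtain ⟨s, s', v', hfinal⟩ := exists_sameOrbit_x₁_eq_zero
    (κ⁻¹ * r) (l⁻¹ * r') (κ⁻¹ * t) (l⁻¹ * t') (κ⁻¹ • z) (l⁻¹ • z')
  exact ⟨s, _, s', v', mul_ne_zero (inv_ne_zero hκ) ht, hclear.trans (hone.trans hfinal)⟩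

end SymmetricRepresentative

section PermStabilizer

variable {n : ℕ}

/-- Permutations of `n` letters as permutations of `n + 1` letters which fix the last one. -/
def permStabilizer :
    Equiv.Perm (Fin n) →* MulAction.stabilizer (Equiv.Perm (Fin (n + 1))) (Fin.last n) :=
  (Equiv.Perm.extendDomainHom (finSuccAboveEquiv (Fin.last n))).codRestrict _ fun σ =>
    Equiv.Perm.extendDomain_apply_not_subtype σ _ (by simp)

theorem permStabilizer_castSucc (σ : Equiv.Perm (Fin n)) (j : Fin n) :
    (permStabilizer σ).1 j.castSucc = (σ j).castSucc := by
  have h := Equiv.Perm.extendDomain_apply_image σ (finSuccAboveEquiv (Fin.last n)) j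
  simp only [finSuccAboveEquiv_apply, Fin.succAbove_last] at h
  exact h

theorem permStabilizer_last (σ : Equiv.Perm (Fin n)) :
    (permStabilizer σ).1 (Fin.last n) = Fin.last n :=
  (permStabilizer σ).2

theorem permStabilizer_bijective : Function.Bijective (permStabilizer (n := n)) := by
  constructor
  · exact (MonoidHom.injective_codRestrict ..).2 (Equiv.Perm.extendDomainHom_injective _)
  · rintro ⟨f, hf : f (Fin.last n) = Fin.last n⟩
    have hne (j : Fin n) : f j.castSucc ≠ Fin.last n := fun h =>
      (Fin.castSucc_lt_last j).ne (f.injective (h.trans hf.symm))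
    have hinj : Function.Injective fun j : Fin n => (f j.castSucc).castPred (hne j) :=
      fun i j h => by simpa using h
    refine ⟨Equiv.ofBijective _ (Finite.injective_iff_bijective.1 hinj),
      Subtype.ext (Equiv.ext fun j => ?_)⟩
    induction j using Fin.lastCases with
    | last => rw [permStabilizer_last, hf]
    | cast j => simp [permStabilizer_castSucc]

end PermStabilizer

section GaloisAction

variable {k : Type*} [Field k]

/-- The composite of a continuous homomorphism to a discrete group with a homomorphism of discrete
groups; `H1.map` is induced by it. -/
def ContHom.map {Γ A B : Type*} [Group Γ] [TopologicalSpace Γ] [IsTopologicalGroup Γ]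
    [Group A] [Group B] (f : A →* B) (φ : ContHom Γ A) : ContHom Γ B :=
  ⟨f.comp φ.1, Subgroup.isOpen_mono (fun σ hσ => by simp [MonoidHom.mem_ker, φ.1.mem_ker.1 hσ]) φ.2⟩

theorem exists_contHom_of_permutes {K ι : Type*} [Field K] [Algebra k K] [Algebra.IsAlgebraic k K]
    [Finite ι] {z : ι → K} (hz : Function.Injective z)
    (h : ∀ (σ : K ≃ₐ[k] K) j, σ (z j) ∈ Set.range z) :
    ∃ φ : ContHom (K ≃ₐ[k] K) (Equiv.Perm ι), ∀ σ j, σ (z j) = z (φ.1 σ j) := by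
  choose e he using h
  let action : MulAction (K ≃ₐ[k] K) ι :=
    { smul := e
      one_smul := fun j => hz (he 1 j)
      mul_smul := fun σ τ j => hz <| by
        change z (e (σ * τ) j) = z (e σ (e τ j))
        rw [he, he, he, AlgEquiv.mul_apply] }
  refine ⟨⟨MulAction.toPermHom (K ≃ₐ[k] K) ι, ?_⟩, fun σ j => (he σ j).symm⟩
  have : FiniteDimensional k (IntermediateField.adjoin k (Set.range z)) :=
    IntermediateField.finiteDimensional_adjoin fun x _ => Algebra.IsIntegral.isIntegral x
  refine Subgroup.isOpen_mono (fun σ hσ => Equiv.ext fun j => hz ?_)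
    (IntermediateField.fixingSubgroup_isOpen (IntermediateField.adjoin k (Set.range z)))
  exact (he σ j).trans (hσ ⟨z j, IntermediateField.subset_adjoin k _ ⟨j, rfl⟩⟩)

theorem exists_injective_range_eq_rootSet {P : Polynomial k} (hP : P.Separable) :
    ∃ z : Fin P.natDegree → SeparableClosure k, Function.Injective z ∧
      Set.range z = P.rootSet (SeparableClosure k) := by
  let e := Fintype.equivFinOfCardEq
    (Polynomial.card_rootSet_eq_natDegree hP
      (IsSepClosed.splits_codomain (K := SeparableClosure k) P hP))
  refine ⟨fun j => e.symm j, Subtype.val_injective.comp e.symm.injective, ?_⟩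
  exact (e.symm.surjective.range_comp Subtype.val).trans Subtype.range_coe

theorem separable_of_discr_ne_zero {P : Cubic k} (ha : P.a ≠ 0) (hP : P.discr ≠ 0) :
    P.toPoly.Separable := by
  have hsplits : (P.toPoly.map (algebraMap k (AlgebraicClosure k))).Splits := IsAlgClosed.splits _
  have hmap : P.toPoly.map (algebraMap k (AlgebraicClosure k)) ≠ 0 :=
    Polynomial.map_ne_zero (Cubic.ne_zero_of_a_ne_zero ha)
  have hnodup := (Cubic.discr_ne_zero_iff_roots_nodup ha hsplits).1 hP
  rwa [Cubic.map_roots, Polynomial.nodup_roots_iff_of_splits hmap hsplits,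
    Polynomial.separable_map] at hnodup

end GaloisAction

section ConicPoints

variable {K L : Type*} [Field K] [Field L]

theorem P2.map_mk (f : K →+* L) (v : Fin 3 → K) (hv : v ≠ 0) :
    P2.map f (.mk K v hv) = .mk L (f ∘ v) (fun h => hv (funext fun i =>
      f.injective ((congrFun h i).trans (map_zero f).symm))) := rfl

variable (K) in
/-- The point `(1 : 0 : 0)`, at which both conics of a `conicPair` pass. -/
def vertex : P2 K := .mk K ![1, 0, 0] fun h => one_ne_zero (congrFun h 0)

/-- The point with `y = 1` and given `z`-coordinate on the conic `2xy + sy² + tz² = 0`. -/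
def conicPoint (s t z : K) : P2 K :=
  .mk K ![-(s + t * z ^ 2) / 2, 1, z] fun h => one_ne_zero (congrFun h 1)

theorem map_vertex (f : K →+* L) : P2.map f (vertex K) = vertex L := by
  simp only [vertex, P2.map_mk]
  congr 1
  funext i
  fin_cases i <;> simp

theorem map_conicPoint (f : K →+* L) (s t z : K) :
    P2.map f (conicPoint s t z) = conicPoint (f s) (f t) (f z) := by
  simp only [conicPoint, P2.map_mk]
  congr 1
  funext i
  fin_cases i <;> simp [map_ofNat f 2]

theorem mk_eq_vertex_iff (v : Fin 3 → K) (hv : v ≠ 0) :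
    .mk K v hv = vertex K ↔ v 1 = 0 ∧ v 2 = 0 := by
  rw [vertex, Projectivization.mk_eq_mk_iff']
  constructor
  · rintro ⟨a, rfl⟩
    simp
  · rintro ⟨h₁, h₂⟩
    refine ⟨v 0, funext fun i => ?_⟩
    fin_cases i <;> simp [h₁, h₂]

theorem mk_eq_conicPoint_iff (h2 : (2 : K) ≠ 0) (s t z : K) (v : Fin 3 → K) (hv : v ≠ 0) :
    .mk K v hv = conicPoint s t z ↔
      v 1 ≠ 0 ∧ v 2 = v 1 * z ∧ 2 * v 0 + v 1 * (s + t * z ^ 2) = 0 := by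
  rw [conicPoint, Projectivization.mk_eq_mk_iff']
  constructor
  · rintro ⟨a, rfl⟩
    refine ⟨fun h => hv ?_, by simp, ?_⟩
    · rw [show a = 0 by simpa using h, zero_smul]
    · simp only [Pi.smul_apply, Matrix.cons_val, smul_eq_mul]
      field
  · rintro ⟨-, h₂, h₀⟩
    refine ⟨v 1, funext fun i => ?_⟩
    fin_cases i
    · simp only [Fin.zero_eta, Pi.smul_apply, Matrix.cons_val, smul_eq_mul]
      field_simp
      linear_combination -h₀
    · simp
    · simp [h₂]

theorem conicPoint_injective (s t : K) : Function.Injective (conicPoint s t) := by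
  intro z w h
  obtain ⟨a, ha⟩ := (Projectivization.mk_eq_mk_iff' ..).1 h
  have ha₁ : a = 1 := by simpa using congrFun ha 1
  simpa [ha₁] using (congrFun ha 2).symm

theorem conicPoint_ne_vertex (s t z : K) : conicPoint s t z ≠ vertex K := fun h =>
  one_ne_zero ((mk_eq_vertex_iff _ _).1 h).1

/-- The points `conicPoint s t (z j)`, followed by `vertex`. -/
def conicPoints {n : ℕ} (s t : K) (z : Fin n → K) : Fin (n + 1) → P2 K :=
  Fin.snoc (α := fun _ => P2 K) (conicPoint s t ∘ z) (vertex K)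

variable {n : ℕ}

theorem conicPoints_injective (s t : K) {z : Fin n → K} (hz : Function.Injective z) :
    Function.Injective (conicPoints s t z) := by
  refine Fin.snoc_injective_of_injective ((conicPoint_injective s t).comp hz) ?_
  rintro ⟨j, hj⟩
  exact conicPoint_ne_vertex s t (z j) hj

theorem range_conicPoints (s t : K) (z : Fin n → K) :
    Set.range (conicPoints s t z) = insert (vertex K) (conicPoint s t '' Set.range z) := by
  rw [conicPoints, Fin.range_snoc, Set.range_comp]

theorem map_comp_conicPoints (f : K →+* L) (s t : K) (z : Fin n → K) :
    P2.map f ∘ conicPoints s t z = conicPoints (f s) (f t) (f ∘ z) := by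
  rw [conicPoints, conicPoints, Fin.comp_snoc, map_vertex]
  congr 1
  exact funext fun j => map_conicPoint f s t (z j)

theorem conicPoints_comp_perm (s t : K) (z : Fin n → K) (σ : Equiv.Perm (Fin n)) :
    conicPoints s t (z ∘ σ) = conicPoints s t z ∘ (permStabilizer σ).1 := by
  funext j
  induction j using Fin.lastCases with
  | last => simp [conicPoints, permStabilizer_last]
  | cast j => simp [conicPoints, permStabilizer_castSucc]

end ConicPoints

section ConicPair

variable {k : Type*} [Field k]

/-- The pair of conics `2xy + sy² + tz² = 0` and `2xz + s'y² + t'z² = 0`. -/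
def conicPair (s t s' t' : k) : QPair k :=
  ![⟨!![0, 1, 0; 1, s, 0; 0, 0, t], Matrix.IsSymm.ext fun i j => by
      fin_cases i <;> fin_cases j <;> rfl⟩,
    ⟨!![0, 0, 1; 0, s', 0; 1, 0, t'], Matrix.IsSymm.ext fun i j => by
      fin_cases i <;> fin_cases j <;> rfl⟩]

/-- The cubic obtained from the equations of `conicPair s t s' t'` by setting `y = 1` and
eliminating `x`; its roots are the `z`-coordinates of the intersection points off `vertex`. -/
def conicCubic (s t s' t' : k) : Cubic k := ⟨t, -t', s, -s'⟩

theorem toV_conicPair (s t s' t' : k) :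
    (conicPair s t s' t').toV = ![J.mk 0 s t 0 0 1, J.mk 0 s' t' 0 1 0] := by
  funext i
  fin_cases i <;>
    refine Prod.ext (funext fun j => ?_) (funext fun j => ?_) <;> fin_cases j <;>
    simp [QPair.toV, TernaryForm.toJ, conicPair, J.mk]

theorem discr_conicCubic_ne_zero (h2 : (2 : k) ≠ 0) {s t s' t' : k}
    (h : ![J.mk 0 s t 0 0 1, J.mk 0 s' t' 0 1 0] ∈ Vss k) :
    (conicCubic s t s' t').discr ≠ 0 := by
  have hdiscr : (binaryCubic J.det ![J.mk 0 s t 0 0 1, J.mk 0 s' t' 0 1 0]).discr ≠ 0 := h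
  rw [binaryCubic_det h2] at hdiscr
  convert hdiscr using 1
  simp only [Cubic.discr, conicCubic, Matrix.cons_val_zero, Matrix.cons_val_one, J.det_mk,
    J.detDeriv_mk, Octonion.tr_zero, Octonion.norm_zero, Octonion.norm_one, Octonion.conj_zero,
    Octonion.conj_one, zero_mul, mul_zero]
  ring

theorem mem_rootSet_conicCubic {K : Type*} [Field K] [Algebra k K] {s t s' t' : k} (ht : t ≠ 0)
    {z : K} : z ∈ (conicCubic s t s' t').toPoly.rootSet K ↔
      algebraMap k K t * z ^ 3 - algebraMap k K t' * z ^ 2 + algebraMap k K s * z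
        - algebraMap k K s' = 0 := by
  rw [Polynomial.mem_rootSet_of_ne (Cubic.ne_zero_of_a_ne_zero ht)]
  simp [conicCubic, Cubic.toPoly, sub_eq_add_neg]

theorem mk_mem_zeroP2_conicPair (s t s' t' : k) (v : Fin 3 → AlgebraicClosure k) (hv : v ≠ 0) :
    .mk _ v hv ∈ zeroP2 (conicPair s t s' t') ↔
      2 * v 0 * v 1 + algebraMap k _ s * v 1 ^ 2 + algebraMap k _ t * v 2 ^ 2 = 0 ∧
      2 * v 0 * v 2 + algebraMap k _ s' * v 1 ^ 2 + algebraMap k _ t' * v 2 ^ 2 = 0 := by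
  obtain ⟨a, ha⟩ := Projectivization.exists_smul_eq_mk_rep (AlgebraicClosure k) v hv
  have ha₀ : (a : AlgebraicClosure k) ^ 2 ≠ 0 := pow_ne_zero 2 a.ne_zero
  simp only [zeroP2, Set.mem_ofPred_eq, ← ha, Fin.forall_fin_two]
  refine and_congr ?_ ?_ <;> refine Iff.trans (Eq.congr_left ?_) (mul_eq_zero_iff_left ha₀) <;>
    simp only [conicPair, dotProduct, Matrix.mulVec, Fin.sum_univ_three, Pi.smul_apply,
      Units.smul_def, smul_eq_mul, Matrix.map_apply, Matrix.of_apply, Matrix.cons_val',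
      Matrix.cons_val_zero, Matrix.cons_val_one, Matrix.cons_val_fin_one, Matrix.cons_val,
      map_zero, map_one] <;>
    ring

theorem vertex_mem_zeroP2_conicPair (s t s' t' : k) :
    vertex (AlgebraicClosure k) ∈ zeroP2 (conicPair s t s' t') := by
  simp [vertex, mk_mem_zeroP2_conicPair]

theorem zeroP2_conicPair (h2 : (2 : k) ≠ 0) (s s' t' : k) {t : k} (ht : t ≠ 0) :
    zeroP2 (conicPair s t s' t') = insert (vertex (AlgebraicClosure k))
      (conicPoint (algebraMap k _ s) (algebraMap k _ t) ''
        (conicCubic s t s' t').toPoly.rootSet (AlgebraicClosure k)) := by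
  have h2' : (2 : AlgebraicClosure k) ≠ 0 := by
    simpa only [map_ofNat] using (map_ne_zero (algebraMap k (AlgebraicClosure k))).2 h2
  have ht' : algebraMap k (AlgebraicClosure k) t ≠ 0 := (map_ne_zero _).2 ht
  ext p
  induction p using Projectivization.ind with | _ v hv
  simp only [Set.mem_insert_iff, Set.mem_image, eq_comm (b := Projectivization.mk _ v hv),
    mk_mem_zeroP2_conicPair, mk_eq_vertex_iff, mk_eq_conicPoint_iff h2', mem_rootSet_conicCubic ht]
  constructor
  · rintro ⟨hfirst, hsecond⟩
    by_cases hv₁ : v 1 = 0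
    · exact .inl ⟨hv₁, by simpa [hv₁, ht'] using hfirst⟩
    · refine .inr ⟨v 2 / v 1, ?_, hv₁, by field, ?_⟩
      · field_simp
        linear_combination v 2 * hfirst - v 1 * hsecond
      · field_simp
        linear_combination hfirst
  · rintro (⟨hv₁, hv₂⟩ | ⟨z, hz, -, hv₂, hv₀⟩)
    · simp [hv₁, hv₂]
    · rw [hv₂]
      constructor
      · linear_combination v 1 * hv₀
      · linear_combination v 1 * z * hv₀ - v 1 ^ 2 * hz

theorem exists_isClassOf_conicPair (h2 : (2 : k) ≠ 0) {s t s' t' : k} (ht : t ≠ 0)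
    (hdiscr : (conicCubic s t s' t').discr ≠ 0) :
    ∃ c : H1 (GalSep k) S, IsClassOf (conicPair s t s' t') (H1.map S.subtype c) := by
  have hsep := separable_of_discr_ne_zero (P := conicCubic s t s' t') ht hdiscr
  obtain ⟨z, hz, hrange⟩ : ∃ z : Fin 3 → SeparableClosure k, Function.Injective z ∧
      Set.range z = (conicCubic s t s' t').toPoly.rootSet (SeparableClosure k) :=
    Cubic.natDegree_of_a_ne_zero (P := conicCubic s t s' t') ht ▸
      exists_injective_range_eq_rootSet hsep
  obtain ⟨φ, hφ⟩ := exists_contHom_of_permutes (k := k) hz fun σ j => by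
    rw [hrange]
    exact Polynomial.smul_mem_rootSet σ (hrange ▸ Set.mem_range_self j)
  refine ⟨Quotient.mk _ (φ.map permStabilizer), conicPoints (algebraMap k _ s) (algebraMap k _ t) z,
    conicPoints_injective _ _ hz, ?_, _, fun σ j => ?_, rfl⟩
  · let incl := IsScalarTower.toAlgHom k (SeparableClosure k) (AlgebraicClosure k)
    have hroots : Set.range (incl ∘ z) =
        (conicCubic s t s' t').toPoly.rootSet (AlgebraicClosure k) := by
      rw [Set.range_comp, hrange]
      exact (IsSepClosed.splits_codomain _ hsep).image_rootSet incl
    rw [zeroP2_conicPair h2 s s' t' ht, ← hroots, ← range_conicPoints]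
    exact congrArg Set.range (map_comp_conicPoints _ _ _ _)
  · have hmap := map_comp_conicPoints (σ : SeparableClosure k →+* SeparableClosure k)
      (algebraMap k _ s) (algebraMap k _ t) z
    have hσz : (σ : SeparableClosure k →+* SeparableClosure k) ∘ z = z ∘ φ.1 σ := funext (hφ σ)
    rw [hσz, conicPoints_comp_perm, RingHom.coe_coe, AlgEquiv.commutes, AlgEquiv.commutes] at hmap
    exact congrFun hmap j

end ConicPair

end JordanPairs

end

theorem mainTheorem2_general {k : Type*} [Field k] (h2 : (2 : k) ≠ 0) :
    Nonempty (S ≃* Equiv.Perm (Fin 3)) ∧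
    ∀ y ∈ Vss k, ∃ x ∈ QPairss k,
      x.toV ∈ MulAction.orbit (G k) y ∧
      (∃ q : P2 k, P2.map (algebraMap k (AlgebraicClosure k)) q ∈ zeroP2 x) ∧
      ∃ c : H1 (GalSep k) S, IsClassOf x (H1.map S.subtype c) := by
  refine ⟨⟨(MulEquiv.ofBijective permStabilizer permStabilizer_bijective).symm⟩, fun y hy => ?_⟩
  obtain ⟨s, t, s', t', ht, horbit⟩ := (hasIsotropicRow_of_mem_Vss h2 hy).exists_sameOrbit h2
  have hmem := horbit.mem_Vss h2 hy
  refine ⟨conicPair s t s' t', ?_, ?_, ⟨vertex k, ?_⟩,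
    exists_isClassOf_conicPair h2 ht (discr_conicCubic_ne_zero h2 hmem)⟩
  · rwa [← toV_mem_Vss_iff, toV_conicPair]
  · rw [toV_conicPair]; exact horbit
  · rw [map_vertex]; exact vertex_mem_zeroP2_conicPair s t s' t'

theorem mainTheorem2 {k : Type*} [Field k] [Infinite k] (h2 : (2 : k) ≠ 0) (h3 : (3 : k) ≠ 0) :
    Nonempty (S ≃* Equiv.Perm (Fin 3)) ∧
    ∀ y ∈ Vss k, ∃ x ∈ QPairss k,
      x.toV ∈ MulAction.orbit (G k) y ∧
      (∃ q : P2 k, P2.map (algebraMap k (AlgebraicClosure k)) q ∈ zeroP2 x) ∧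
      ∃ c : H1 (GalSep k) S, IsClassOf x (H1.map S.subtype c) := by
  exact mainTheorem2_general h2
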